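/- Let $\mathbb{K}$ be an algebraically closed field of characteristic $0$. Let $\mathcal{L}ie_{11}\subset\mathbb{K}^{11^3}$ be the affine variety of structure constants $(C_{ij}^k)_{0\le i,j,k\le 10}$ of Lie brackets on $\mathbb{K}^{11}$ (skew-symmetry and Jacobi identity), with its Zariski topology and with the action of $GL(11,\mathbb{K})$ by changes of basis, whose orbits are the isomorphism classes. Let $\mathcal{F}il_{11}\subset\mathcal{N}il_{11}\subset\mathcal{L}ie_{11}$ be the subsets of filiform and of nilpotent Lie algebras, where an $n$-dimensional Lie algebra is called filiform if it is nilpotent and the terms of its ascending central series satisfy $\dim\mathcal{C}_i=i$ for $0\le i\le n-2$. Let $Fil_{11}\subset\mathcal{F}il_{11}$ be the subset of those filiform Lie algebras for which the standard basis $X_0,\dots,X_{10}$ is a Vergne basis, that is, $[X_0,X_i]=X_{i+1}$ for $1\le i\le 9$, $[X_1,X_9]=0$ and $[X_i,X_j]\in\mathrm{span}(X_k : k\ge i+j)$ for $i,j\ge 1$. For $S$ one of these four sets, call a Lie algebra rigid in $S$ if the intersection of its orbit with $S$ is Zariski open in $S$ (for the induced topology). Then no $11$-dimensional filiform Lie algebra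 over $\mathbb{K}$ is rigid in $Fil_{11}$, in $\mathcal{F}il_{11}$, in $\mathcal{N}il_{11}$ or in $\mathcal{L}ie_{11}$. -/

import Mathlib

namespace Filiform

section Algebras

variable (K : Type*) [Field K] (L : Type*) [LieRing L] [LieAlgebra K L]

/-- A filiform Lie algebra: a nilpotent `n`-dimensional Lie algebra whose ascending central series
`C₀ = 0`, `C_{i+1} = {x | [x, L] ⊆ C_i}` satisfies `dim C_i = i` for `0 ≤ i ≤ n - 2`
(equivalently, a nilpotent Lie algebra of maximal nilindex `n - 1`). -/
structure IsFiliform : Prop where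
  finiteDimensional : Module.Finite K L
  nilpotent : LieRing.IsNilpotent L
  finrank_ucs : ∀ i : ℕ, i ≤ Module.finrank K L - 2 →
    Module.finrank K ((⊥ : LieSubmodule K L L).ucs i) = i

end Algebras

section Points

variable (n : ℕ) (K : Type*) [Field K]

/-- The affine space of all families `c (i, j, k)` (the coefficient of `X_k` in `[X_i, X_j]`),
that is, of all bilinear products on `Kⁿ`. -/
abbrev Point : Type _ := Fin n × Fin n × Fin n → K

variable {n K}

/-- The bilinear product on `Kⁿ` with structure constants `c`. -/
def bracket (c : Point n K) : (Fin n → K) →ₗ[K] (Fin n → K) →ₗ[K] (Fin n → K) :=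
  LinearMap.mk₂ K (fun x y k => ∑ i, ∑ j, x i * y j * c (i, j, k))
    (fun x x' y => by
      funext k; simp only [Pi.add_apply, add_mul, Finset.sum_add_distrib])
    (fun a x y => by
      funext k; simp only [Pi.smul_apply, smul_eq_mul, Finset.mul_sum, mul_assoc])
    (fun x y y' => by
      funext k; simp only [Pi.add_apply, mul_add, add_mul, Finset.sum_add_distrib])
    (fun a x y => by
      funext k; simp only [Pi.smul_apply, smul_eq_mul, Finset.mul_sum]
      exact Finset.sum_congr rfl fun i _ => Finset.sum_congr rfl fun j _ => by ring)

lemma bracket_apply (c : Point n K) (x y : Fin n → K) (k : Fin n) :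
    bracket c x y k = ∑ i, ∑ j, x i * y j * c (i, j, k) := rfl

lemma bracket_single (c : Point n K) (i j k : Fin n) :
    bracket c (Pi.single i 1) (Pi.single j 1) k = c (i, j, k) := by
  rw [bracket_apply, Finset.sum_eq_single i, Finset.sum_eq_single j]
  · simp
  · intro b _ hb; simp [hb]
  · simp
  · intro b _ hb; simp [hb]
  · simp

variable (n K) in
/-- The variety of `n`-dimensional Lie algebras: skew-symmetry and the Jacobi identity. -/
def lieVariety : Set (Point n K) :=
  {c | (∀ i j k, c (i, j, k) = -c (j, i, k)) ∧
    ∀ i j k s, ∑ l, (c (i, j, l) * c (l, k, s) + c (j, k, l) * c (l, i, s)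
      + c (k, i, l) * c (l, j, s)) = 0}

/-- The vector space `Kⁿ`, to be equipped with the Lie bracket given by a point of the variety of
Lie algebras. -/
def AlgebraOf (_c : lieVariety n K) : Type _ := Fin n → K

namespace AlgebraOf

variable (c : lieVariety n K)

instance : AddCommGroup (AlgebraOf c) := inferInstanceAs (AddCommGroup (Fin n → K))

instance : Module K (AlgebraOf c) := inferInstanceAs (Module K (Fin n → K))

end AlgebraOf

lemma bracket_skew {c : Point n K} (hc : c ∈ lieVariety n K) (x y : Fin n → K) :
    bracket c x y = -bracket c y x := by
  have h : bracket c = -(bracket c).flip := by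
    refine LinearMap.ext_basis (Pi.basisFun K (Fin n)) (Pi.basisFun K (Fin n)) fun i j => ?_
    funext k
    simp only [Pi.basisFun_apply, LinearMap.neg_apply, LinearMap.flip_apply, Pi.neg_apply,
      bracket_single]
    exact hc.1 i j k
  have := LinearMap.congr_fun₂ h x y
  simpa using this

lemma bracket_bracket_single (c : Point n K) (i j k s : Fin n) :
    bracket c (bracket c (Pi.single i 1) (Pi.single j 1)) (Pi.single k 1) s
      = ∑ l, c (i, j, l) * c (l, k, s) := by
  rw [bracket_apply]
  refine Finset.sum_congr rfl fun l _ => ?_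
  rw [Finset.sum_eq_single k]
  · rw [bracket_single]; simp
  · intro b _ hb; simp [hb]
  · simp

lemma bracket_jacobi {c : Point n K} (hc : c ∈ lieVariety n K) (x y z : Fin n → K) :
    bracket c (bracket c x y) z + bracket c (bracket c y z) x + bracket c (bracket c z x) y
      = 0 := by
  have key : ∀ i j k : Fin n,
      bracket c (bracket c (Pi.single i 1) (Pi.single j 1)) (Pi.single k 1)
      + bracket c (bracket c (Pi.single j 1) (Pi.single k 1)) (Pi.single i 1)
      + bracket c (bracket c (Pi.single k 1) (Pi.single i 1)) (Pi.single j 1) = 0 := by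
    intro i j k
    funext s
    simp only [Pi.add_apply, bracket_bracket_single, Pi.zero_apply]
    rw [← Finset.sum_add_distrib, ← Finset.sum_add_distrib]
    exact hc.2 i j k s
  have hz : ∀ i j : Fin n, ∀ z : Fin n → K,
      bracket c (bracket c (Pi.single i 1) (Pi.single j 1)) z
      + bracket c (bracket c (Pi.single j 1) z) (Pi.single i 1)
      + bracket c (bracket c z (Pi.single i 1)) (Pi.single j 1) = 0 := by
    intro i j z
    have h : bracket c (bracket c (Pi.single i 1) (Pi.single j 1))
        + (bracket c).flip (Pi.single i 1) ∘ₗ bracket c (Pi.single j 1)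
        + (bracket c).flip (Pi.single j 1) ∘ₗ (bracket c).flip (Pi.single i 1) = 0 :=
      (Pi.basisFun K (Fin n)).ext fun k => by simpa using key i j k
    simpa using LinearMap.congr_fun h z
  have hy : ∀ i : Fin n, ∀ y z : Fin n → K,
      bracket c (bracket c (Pi.single i 1) y) z
      + bracket c (bracket c y z) (Pi.single i 1)
      + bracket c (bracket c z (Pi.single i 1)) y = 0 := by
    intro i y z
    have h : (bracket c).flip z ∘ₗ bracket c (Pi.single i 1)
        + (bracket c).flip (Pi.single i 1) ∘ₗ (bracket c).flip z
        + bracket c (bracket c z (Pi.single i 1)) = 0 :=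
      (Pi.basisFun K (Fin n)).ext fun j => by simpa using hz i j z
    simpa using LinearMap.congr_fun h y
  have h : (bracket c).flip z ∘ₗ (bracket c).flip y
        + bracket c (bracket c y z)
        + (bracket c).flip y ∘ₗ bracket c z = 0 :=
      (Pi.basisFun K (Fin n)).ext fun i => by simpa using hy i y z
  simpa using LinearMap.congr_fun h x

namespace AlgebraOf

variable [CharZero K] (c : lieVariety n K)

instance : LieRing (AlgebraOf c) where
  bracket x y := bracket c.1 x y
  add_lie x y z := LinearMap.map_add₂ (bracket c.1) x y z
  lie_add x y z := map_add (bracket c.1 x) y z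
  lie_self x := by
    have h : bracket c.1 x x = -bracket c.1 x x := bracket_skew c.2 x x
    exact (self_eq_neg (G := Fin n → K)).mp h
  leibniz_lie x y z := by
    have h := bracket_jacobi c.2 x y z
    have h1 : bracket c.1 (bracket c.1 y z) x = -bracket c.1 x (bracket c.1 y z) :=
      bracket_skew c.2 _ _
    have h2 : bracket c.1 (bracket c.1 z x) y = bracket c.1 y (bracket c.1 x z) := by
      rw [bracket_skew c.2 _ y, bracket_skew c.2 z x, map_neg, neg_neg]
    rw [h1, h2] at h
    change bracket c.1 x (bracket c.1 y z)
      = bracket c.1 (bracket c.1 x y) z + bracket c.1 y (bracket c.1 x z)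
    rw [← sub_eq_zero, ← neg_eq_zero, ← h]
    abel

instance : LieAlgebra K (AlgebraOf c) where
  lie_smul t x y := map_smul (bracket c.1 x) t y

end AlgebraOf

variable (n K) in
/-- The set of nilpotent Lie algebras of dimension `n`. -/
def nilVariety [CharZero K] : Set (Point n K) :=
  {c | ∃ hc : c ∈ lieVariety n K, LieRing.IsNilpotent (AlgebraOf ⟨c, hc⟩)}

variable (n K) in
/-- The set of filiform Lie algebras of dimension `n`. -/
def filSet [CharZero K] : Set (Point n K) :=
  {c | ∃ hc : c ∈ lieVariety n K, IsFiliform K (AlgebraOf ⟨c, hc⟩)}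

variable (n K) in
/-- The set of filiform Lie algebras of dimension `n` for which the standard basis
`X_0, …, X_{n-1}` is a Vergne basis: `[X_0, X_i] = X_{i+1}` for `1 ≤ i ≤ n - 2`,
`[X_1, X_{n-2}] = 0`, and `[X_i, X_j]` is a combination of the `X_k` with `k ≥ i + j`
for `i, j ≥ 1`. -/
def vergneFilSet [CharZero K] : Set (Point n K) :=
  {c | c ∈ filSet n K ∧
    (∀ z i k : Fin n, z.1 = 0 → 1 ≤ i.1 → i.1 + 1 < n →
      c (z, i, k) = if k.1 = i.1 + 1 then 1 else 0) ∧
    (∀ i j k : Fin n, i.1 = 1 → j.1 + 2 = n → c (i, j, k) = 0) ∧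
    (∀ i j k : Fin n, 1 ≤ i.1 → 1 ≤ j.1 → k.1 < i.1 + j.1 → c (i, j, k) = 0)}

/-- The action of `GL(n, K)` on products: `(g • μ)(x, y) = g (μ (g⁻¹ x, g⁻¹ y))`. -/
def changeBasis (g : (Fin n → K) ≃ₗ[K] (Fin n → K)) (c : Point n K) : Point n K :=
  fun p => g (bracket c (g.symm (Pi.single p.1 1)) (g.symm (Pi.single p.2.1 1))) p.2.2

/-- The orbit of a product under `GL(n, K)`, that is, its isomorphism class. -/
def orbit (c : Point n K) : Set (Point n K) :=
  {c' | ∃ g : (Fin n → K) ≃ₗ[K] (Fin n → K), c' = changeBasis g c}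

/-- `T` is open in `S` for the topology induced on `S` by the Zariski topology. -/
def IsZariskiOpenIn (S T : Set (Point n K)) : Prop :=
  ∃ I : Ideal (MvPolynomial (Fin n × Fin n × Fin n) K),
    T = S \ MvPolynomial.zeroLocus K I

/-- `c` is rigid in the family `S`: the part in `S` of its orbit is Zariski open in `S`. -/
def IsRigidIn (S : Set (Point n K)) (c : Point n K) : Prop :=
  IsZariskiOpenIn S (S ∩ orbit c)

/-- The structure constants of a Lie algebra in a basis. -/
noncomputable def structureConstants {L : Type*} [LieRing L] [LieAlgebra K L]
    (b : Module.Basis (Fin n) K L) : Point n K :=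
  fun p => b.repr ⁅b p.1, b p.2.1⁆ p.2.2

end Points

end Filiform

/-! Openness in a set restricts to subsets, so it is enough to treat the smallest set,
`vergneFilSet` (`IsRigidIn.mono`). By Vergne's theorem (`IsFiliform.exists_isVergneBasis`) the orbit
meets this set, and a point of it is determined by the coefficients `a i k` of `X_k` in `[X_i,
X_{i+1}]`. Give `a i k` the weight `k - (2 * i + 1)`. In dimension 11 the weight-zero coefficients
vanish (`weight_zero_coeff_eq_zero`), and what is left of the Jacobi identity is the four relations
`JacobiRelations`. All four have degree two in the `a i k`; the names `quadratic`, `cubic`,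
`quartic` record the total weights 2, 3, 4.

Two facts oppose each other. If the orbit is open, then a rational curve of solutions of the
relations through the given point meets the orbit at some parameter `t ≠ 0`
(`IsRigidIn.exists_deformation`). On the other hand, a change of Vergne basis multiplies all
coefficients of lowest nonzero weight `w` by the common factor `m / l ^ (w + 1)`, where `l` and `m`
are the leading coefficients of the new `X_0` and `X_1` (`IsVergneBasis.leading_coeff_eq`). The
ratios of these coefficients are therefore isomorphism invariants.

So it suffices to find a curve along which those ratios change. If `2 * a 1 4 + a 2 6 ≠ 0`, the
relations can be solved for `a 3 8`, `a 4 10`, `a 3 9`, `a 3 10`, and `a 1 4 : a 2 6` can be moved.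
Otherwise `a 1 4 = a 2 6 = 0`, and four degenerate strata remain, each with its own curve: `a 3 8 ≠
0`; only `a 4 10` nonzero in weight one; weight one zero but not weight two; weights one and two
both zero. -/

namespace Filiform

/-! ### Orbits as sets of structure constants of one algebra -/

section Orbits

variable {n : ℕ} {K : Type*} [Field K] {L : Type*} [LieRing L] [LieAlgebra K L]

lemma lie_eq_sum_structureConstants (b : Module.Basis (Fin n) K L) (i j : Fin n) :
    ⁅b i, b j⁆ = ∑ k, structureConstants b (i, j, k) • b k :=
  (b.sum_repr ⁅b i, b j⁆).symm

lemma bracket_structureConstants (b : Module.Basis (Fin n) K L) (x y : L) :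
    bracket (structureConstants b) (b.equivFun x) (b.equivFun y) = b.equivFun ⁅x, y⁆ := by
  have h : ((bracket (structureConstants b)).compl₁₂ b.equivFun.toLinearMap
      b.equivFun.toLinearMap)
      = (LieModule.toEnd K L L : L →ₗ[K] Module.End K L).compr₂ b.equivFun.toLinearMap := by
    refine LinearMap.ext_basis b b fun i j => ?_
    funext k
    have hs : ∀ i : Fin n, b.equivFun (b i) = Pi.single i 1 := fun i => by
      funext l; simp [Pi.single_apply, eq_comm]
    simp only [LinearMap.compl₁₂_apply, LinearEquiv.coe_coe, hs, bracket_single]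
    simp [structureConstants]
  simpa using LinearMap.congr_fun₂ h x y

lemma changeBasis_structureConstants (b : Module.Basis (Fin n) K L)
    (g : (Fin n → K) ≃ₗ[K] (Fin n → K)) :
    changeBasis g (structureConstants b)
      = structureConstants (Module.Basis.ofEquivFun (b.equivFun.trans g)) := by
  funext p
  have h : ∀ v, g.symm v = b.equivFun ((b.equivFun.trans g).symm v) := fun v => by
    rw [LinearEquiv.trans_symm, LinearEquiv.trans_apply, LinearEquiv.apply_symm_apply]
  simp only [changeBasis, h, bracket_structureConstants, structureConstants,
    Module.Basis.coe_ofEquivFun, Module.Basis.ofEquivFun_repr_apply, LinearEquiv.trans_apply]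

/-- Points of the orbit come from bases of the one fixed algebra `L`, so isomorphic points can be
compared inside `L`. -/
lemma exists_basis_of_mem_orbit (b : Module.Basis (Fin n) K L) {c : Point n K}
    (hc : c ∈ orbit (structureConstants b)) :
    ∃ b' : Module.Basis (Fin n) K L, structureConstants b' = c := by
  obtain ⟨g, rfl⟩ := hc
  exact ⟨_, (changeBasis_structureConstants b g).symm⟩

lemma structureConstants_mem_orbit (b b' : Module.Basis (Fin n) K L) :
    structureConstants b' ∈ orbit (structureConstants b) := by
  refine ⟨b.equivFun.symm.trans b'.equivFun, ?_⟩
  rw [changeBasis_structureConstants]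
  congr
  refine Module.Basis.eq_of_apply_eq fun i => ?_
  rw [Module.Basis.coe_ofEquivFun]
  refine (LinearEquiv.eq_symm_apply _).mpr ?_
  funext l
  simp [Pi.single_apply, eq_comm]

lemma sum_structureConstants_mul (b : Module.Basis (Fin n) K L) (i j k s : Fin n) :
    ∑ l, structureConstants b (i, j, l) * structureConstants b (l, k, s)
      = b.repr ⁅⁅b i, b j⁆, b k⁆ s := by
  rw [lie_eq_sum_structureConstants b i j, sum_lie]
  simp only [smul_lie, map_sum, map_smul, Finsupp.coe_finsetSum, Finset.sum_apply,
    Finsupp.smul_apply, smul_eq_mul]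
  rfl

lemma structureConstants_mem_lieVariety (b : Module.Basis (Fin n) K L) :
    structureConstants b ∈ lieVariety n K := by
  refine ⟨fun i j k => ?_, fun i j k s => ?_⟩
  · simp only [structureConstants]
    rw [← lie_skew, map_neg, Finsupp.neg_apply]
  · rw [Finset.sum_add_distrib, Finset.sum_add_distrib, sum_structureConstants_mul,
      sum_structureConstants_mul, sum_structureConstants_mul, ← Finsupp.add_apply,
      ← Finsupp.add_apply, ← map_add, ← map_add]
    have h := lie_jacobi (b i) (b j) (b k)
    rw [← lie_skew (b i) ⁅b j, b k⁆, ← lie_skew (b j) ⁅b k, b i⁆,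
      ← lie_skew (b k) ⁅b i, b j⁆] at h
    have h' : ⁅⁅b i, b j⁆, b k⁆ + ⁅⁅b j, b k⁆, b i⁆ + ⁅⁅b k, b i⁆, b j⁆ = 0 := by
      rw [← neg_eq_zero, ← h]; abel
    rw [h']; simp

/-- The standard basis of the Lie algebra with given structure constants. -/
noncomputable def AlgebraOf.stdBasis (c : lieVariety n K) :
    Module.Basis (Fin n) K (AlgebraOf c) :=
  Pi.basisFun K (Fin n)

lemma AlgebraOf.structureConstants_stdBasis [CharZero K] (c : lieVariety n K) :
    structureConstants (AlgebraOf.stdBasis c) = c.1 := by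
  funext p
  have h : ∀ i, AlgebraOf.stdBasis c i = (Pi.single i 1 : Fin n → K) :=
    fun i => Pi.basisFun_apply K (Fin n) i
  change (Pi.basisFun K (Fin n)).repr
    (bracket c.1 (AlgebraOf.stdBasis c p.1) (AlgebraOf.stdBasis c p.2.1)) p.2.2 = _
  rw [h, h, Pi.basisFun_repr, bracket_single]

lemma IsRigidIn.mono {S S' : Set (Point n K)} (h : S' ⊆ S) {c : Point n K}
    (hc : IsRigidIn S c) : IsRigidIn S' c := by
  obtain ⟨I, hI⟩ := hc
  refine ⟨I, ?_⟩
  ext x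
  have := Set.ext_iff.mp hI x
  simp only [Set.mem_inter_iff, Set.mem_sdiff] at this ⊢
  constructor
  · rintro ⟨h1, h2⟩; exact ⟨h1, (this.mp ⟨h h1, h2⟩).2⟩
  · rintro ⟨h1, h2⟩; exact ⟨h1, (this.mpr ⟨h h1, h2⟩).2⟩

end Orbits

/-! ### Multiplication table generated by the `[X_i, X_{i+1}]` -/

section Table

variable {K : Type*} [Field K]

/-- The coefficient of `X_k` in `[X_i, X_{i+d}]`, for `i ≥ 1`, in a Lie algebra where `ad X_0`
shifts `X_1, X_2, …` and where `[X_i, X_{i+1}]` has the coefficients `a i k`. -/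
def shiftCoeff (a : ℕ → ℕ → K) : ℕ → ℕ → ℕ → K
  | 0, _, _ => 0
  | 1, i, k => a i k
  -- `[X_i, X_{i+d+2}] = [X_0, [X_i, X_{i+d+1}]] - [X_{i+1}, X_{i+d+1}]`. The truncation of `k - 1`
  -- at `k = 0` is harmless in the intended tables, where coefficients of such low index vanish.
  | d + 2, i, k => shiftCoeff a (d + 1) i (k - 1) - shiftCoeff a d (i + 1) k

/-- The coefficient of `X_k` in `[X_i, X_j]`. -/
def vergneCoeff (a : ℕ → ℕ → K) (i j k : ℕ) : K :=
  if i = 0 then (if 1 ≤ j ∧ k = j + 1 then 1 else 0)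
  else if j = 0 then (if k = i + 1 then -1 else 0)
  else if i ≤ j then shiftCoeff a (j - i) i k else -shiftCoeff a (i - j) j k

/-- The structure constants for which `[X_0, X_i] = X_{i+1}` and `[X_i, X_{i+1}]` has the
coefficients `a i k`, for `i ≥ 1`. -/
def vergnePoint (n : ℕ) (a : ℕ → ℕ → K) : Point n K :=
  fun p => vergneCoeff a p.1 p.2.1 p.2.2

/-- The recursion never raises the target index, so vanishing up to target `N` can be propagated
without knowing anything beyond `N`. This matters when `a 4 10` is nonzero but only targets up to 9
are of interest. -/
lemma shiftCoeff_eq_zero_of_le {a : ℕ → ℕ → K} {w N : ℕ}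
    (ha : ∀ i k, 1 ≤ i → k ≤ N → k < 2 * i + 1 + w → a i k = 0) :
    ∀ d i k, 1 ≤ i → k ≤ N → k < 2 * i + d + w → shiftCoeff a d i k = 0
  | 0, _, _, _, _, _ => rfl
  | 1, i, k, hi, hk, h => ha i k hi hk h
  | d + 2, i, k, hi, hk, h => by
    rw [shiftCoeff, shiftCoeff_eq_zero_of_le ha (d + 1) i (k - 1) hi (by omega) (by omega),
      shiftCoeff_eq_zero_of_le ha d (i + 1) k (by omega) hk (by omega), sub_zero]

lemma vergneCoeff_eq_zero_of_le {a : ℕ → ℕ → K} {w N : ℕ}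
    (ha : ∀ i k, 1 ≤ i → k ≤ N → k < 2 * i + 1 + w → a i k = 0) {i j k : ℕ} (hi : 1 ≤ i)
    (hj : 1 ≤ j) (hk : k ≤ N) (h : k < i + j + w) : vergneCoeff a i j k = 0 := by
  unfold vergneCoeff
  rw [if_neg (by omega), if_neg (by omega)]
  split_ifs
  · exact shiftCoeff_eq_zero_of_le ha _ _ _ hi hk (by omega)
  · rw [shiftCoeff_eq_zero_of_le ha _ _ _ hj hk (by omega), neg_zero]

lemma vergneCoeff_eq_zero {a : ℕ → ℕ → K} {w : ℕ}
    (ha : ∀ i k, 1 ≤ i → k < 2 * i + 1 + w → a i k = 0) {i j k : ℕ} (hi : 1 ≤ i) (hj : 1 ≤ j)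
    (h : k < i + j + w) : vergneCoeff a i j k = 0 :=
  vergneCoeff_eq_zero_of_le (N := k) (fun i k hi _ => ha i k hi) hi hj le_rfl h

lemma vergneCoeff_zero_left (a : ℕ → ℕ → K) {j : ℕ} (hj : 1 ≤ j) (k : ℕ) :
    vergneCoeff a 0 j k = if k = j + 1 then 1 else 0 := by
  simp [vergneCoeff, hj]

lemma vergneCoeff_self (a : ℕ → ℕ → K) (i k : ℕ) : vergneCoeff a i i k = 0 := by
  unfold vergneCoeff
  split_ifs <;> first | rfl | omega | simp [shiftCoeff]

lemma vergneCoeff_skew (a : ℕ → ℕ → K) (i j k : ℕ) :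
    vergneCoeff a i j k = -vergneCoeff a j i k := by
  rcases lt_trichotomy i j with h | h | h
  · unfold vergneCoeff
    split_ifs <;> first | omega | simp
  · subst h; simp [vergneCoeff_self]
  · unfold vergneCoeff
    split_ifs <;> first | omega | simp

lemma vergneCoeff_succ (a : ℕ → ℕ → K) {i : ℕ} (hi : 1 ≤ i) (k : ℕ) :
    vergneCoeff a i (i + 1) k = a i k := by
  unfold vergneCoeff
  rw [if_neg (by omega), if_neg (by omega), if_pos (by omega), Nat.add_sub_cancel_left]
  rfl

lemma vergneCoeff_shift_of_lt (a : ℕ → ℕ → K) {i j : ℕ} (hi : 1 ≤ i) (hij : i < j) (k : ℕ) :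
    vergneCoeff a i j (k - 1) = vergneCoeff a (i + 1) j k + vergneCoeff a i (j + 1) k := by
  obtain ⟨d, rfl⟩ := Nat.exists_eq_add_of_lt hij
  unfold vergneCoeff
  rw [if_neg (by omega), if_neg (by omega), if_pos (by omega), if_neg (by omega),
    if_neg (by omega), if_pos (by omega), if_neg (by omega), if_neg (by omega), if_pos (by omega),
    show i + d + 1 - i = d + 1 by omega, show i + d + 1 - (i + 1) = d by omega,
    show i + d + 1 + 1 - i = d + 2 by omega, shiftCoeff]
  ring

/-- `ad X_0` is a derivation of the product on the span of the `X_i`, `i ≥ 1`. -/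
lemma vergneCoeff_shift (a : ℕ → ℕ → K) {i j : ℕ} (hi : 1 ≤ i) (hj : 1 ≤ j) (k : ℕ) :
    vergneCoeff a i j (k - 1) = vergneCoeff a (i + 1) j k + vergneCoeff a i (j + 1) k := by
  rcases lt_trichotomy i j with h | rfl | h
  · exact vergneCoeff_shift_of_lt a hi h k
  · rw [vergneCoeff_self, vergneCoeff_skew a (i + 1), neg_add_cancel]
  · rw [vergneCoeff_skew a i j, vergneCoeff_shift_of_lt a hj h k, vergneCoeff_skew a (i + 1) j,
      vergneCoeff_skew a i (j + 1)]
    ring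

/-- The Jacobi relations of an 11-dimensional Lie algebra in terms of the coefficients of the
`[X_i, X_{i+1}]`. -/
structure JacobiRelations (a : ℕ → ℕ → K) : Prop where
  quadratic_one : 3 * a 2 6 ^ 2 - 2 * a 1 4 * a 3 8 - a 2 6 * a 3 8 = 0
  quadratic_two : a 4 10 * (a 2 6 + a 3 8 - 2 * a 1 4) + 4 * a 2 6 * a 3 8 - 6 * a 3 8 ^ 2 = 0
  cubic : (7 * a 2 6 - 3 * a 3 8) * a 2 7 - 3 * a 3 8 * a 1 5 - (2 * a 1 4 + a 2 6) * a 3 9 = 0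
  quartic : (2 * a 4 10 - 4 * a 3 8) * a 1 6 + (8 * a 2 6 - 6 * a 3 8 + a 4 10) * a 2 8
    - (2 * a 1 4 + a 2 6) * a 3 10 + 4 * a 2 7 ^ 2 - 3 * a 1 5 * a 3 9 - 3 * a 2 7 * a 3 9 = 0

/-- The coefficient of `X_s` in the Jacobi sum of `X_i`, `X_j`, `X_k`. -/
def jacobiSum (a : ℕ → ℕ → K) (n i j k s : ℕ) : K :=
  ∑ l ∈ Finset.range n, (vergneCoeff a i j l * vergneCoeff a l k s
    + vergneCoeff a j k l * vergneCoeff a l i s + vergneCoeff a k i l * vergneCoeff a l j s)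

lemma jacobiSum_rotate (a : ℕ → ℕ → K) (n i j k s : ℕ) :
    jacobiSum a n i j k s = jacobiSum a n j k i s :=
  Finset.sum_congr rfl fun l _ => by ring

lemma jacobiSum_swap (a : ℕ → ℕ → K) (n i j k s : ℕ) :
    jacobiSum a n i j k s = -jacobiSum a n j i k s := by
  rw [jacobiSum, jacobiSum, ← Finset.sum_neg_distrib]
  refine Finset.sum_congr rfl fun l _ => ?_
  rw [vergneCoeff_skew a i j, vergneCoeff_skew a j k, vergneCoeff_skew a k i]
  ring

lemma jacobiSum_self (a : ℕ → ℕ → K) (n i k s : ℕ) : jacobiSum a n i i k s = 0 := by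
  refine Finset.sum_eq_zero fun l _ => ?_
  rw [vergneCoeff_self, vergneCoeff_skew a k i]
  ring

/-- Each of the two nested brackets raises the degree by `w`, so below `i + j + k + 2 * w` every
summand has a zero factor. -/
lemma jacobiSum_eq_zero_of_lt {a : ℕ → ℕ → K} {w : ℕ}
    (ha : ∀ i k, 1 ≤ i → k < 2 * i + 1 + w → a i k = 0) (n : ℕ) {i j k s : ℕ} (hi : 1 ≤ i)
    (hj : 1 ≤ j) (hk : 1 ≤ k) (h : s < i + j + k + 2 * w) : jacobiSum a n i j k s = 0 := by
  have key : ∀ i j k l : ℕ, 1 ≤ i → 1 ≤ j → 1 ≤ k → s < i + j + k + 2 * w →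
      vergneCoeff a i j l * vergneCoeff a l k s = 0 := by
    intro i j k l hi hj hk h
    rcases lt_or_ge l (i + j + w) with hl | hl
    · rw [vergneCoeff_eq_zero ha hi hj hl, zero_mul]
    · rw [vergneCoeff_eq_zero ha (by omega) hk (by omega), mul_zero]
  refine Finset.sum_eq_zero fun l _ => ?_
  rw [key i j k l hi hj hk h, key j k i l hj hk hi (by omega), key k i j l hk hi hj (by omega)]
  ring

/-- Triples containing `X_0` impose nothing: the table was built so that `ad X_0` is a derivation
(`vergneCoeff_shift`). -/
lemma jacobiSum_zero_left {a : ℕ → ℕ → K} (ha : ∀ i k, 1 ≤ i → k < 2 * i + 1 → a i k = 0)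
    {n i j s : ℕ} (hi : 1 ≤ i) (hj : 1 ≤ j) (hs : s < n) : jacobiSum a n 0 i j s = 0 := by
  have hs0 : ∀ i j : ℕ, 1 ≤ i → 1 ≤ j → ∑ l ∈ Finset.range n,
      vergneCoeff a 0 i l * vergneCoeff a l j s = vergneCoeff a (i + 1) j s := by
    intro i j hi hj
    simp only [vergneCoeff_zero_left a hi, ite_mul, one_mul, zero_mul, Finset.sum_ite_eq',
      Finset.mem_range]
    split_ifs with h
    · rfl
    · exact (vergneCoeff_eq_zero (w := 0) ha (by omega) hj (by omega)).symm
  have hmid : ∑ l ∈ Finset.range n, vergneCoeff a i j l * vergneCoeff a l 0 s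
      = -vergneCoeff a i j (s - 1) := by
    rw [Finset.sum_eq_single (s - 1)]
    · rcases Nat.lt_or_ge s 2 with h | h
      · rw [vergneCoeff_eq_zero (w := 0) ha hi hj (by omega)]; simp
      · rw [vergneCoeff_skew a _ 0, vergneCoeff_zero_left a (by omega), if_pos (by omega)]; simp
    · intro l _ hl
      rcases Nat.eq_zero_or_pos l with rfl | h
      · rw [vergneCoeff_self, mul_zero]
      · rw [vergneCoeff_skew a _ 0, vergneCoeff_zero_left a h, if_neg (by omega)]; simp
    · intro h; exact absurd (Finset.mem_range.mpr (by omega)) h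
  rw [jacobiSum, Finset.sum_add_distrib, Finset.sum_add_distrib, hs0 i j hi hj, hmid]
  have h3 : ∑ l ∈ Finset.range n, vergneCoeff a j 0 l * vergneCoeff a l i s
      = -vergneCoeff a (j + 1) i s := by
    rw [← hs0 j i hj hi, ← Finset.sum_neg_distrib]
    refine Finset.sum_congr rfl fun l _ => ?_
    rw [vergneCoeff_skew a j 0]; ring
  rw [h3, vergneCoeff_shift a hi hj, vergneCoeff_skew a (j + 1) i]
  ring

lemma vergnePoint_mem_lieVariety_iff (n : ℕ) (a : ℕ → ℕ → K) :
    vergnePoint n a ∈ lieVariety n K ↔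
      ∀ i < n, ∀ j < n, ∀ k < n, ∀ s < n, jacobiSum a n i j k s = 0 := by
  have h : ∀ i j k s : Fin n, ∑ l, (vergnePoint n a (i, j, l) * vergnePoint n a (l, k, s)
      + vergnePoint n a (j, k, l) * vergnePoint n a (l, i, s)
      + vergnePoint n a (k, i, l) * vergnePoint n a (l, j, s)) = jacobiSum a n i j k s :=
    fun i j k s => Fin.sum_univ_eq_sum_range (fun l => vergneCoeff a i j l * vergneCoeff a l k s
      + vergneCoeff a j k l * vergneCoeff a l i s + vergneCoeff a k i l * vergneCoeff a l j s) n
  constructor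
  · intro hc i hi j hj k hk s hs
    exact (h ⟨i, hi⟩ ⟨j, hj⟩ ⟨k, hk⟩ ⟨s, hs⟩).symm.trans (hc.2 _ _ _ _)
  · exact fun hJ => ⟨fun i j k => vergneCoeff_skew a i j k, fun i j k s =>
      (h i j k s).trans (hJ i i.2 j j.2 k k.2 s s.2)⟩

end Table

/-! ### The Jacobi identity in dimension 11 -/

section Jacobi

variable {K : Type*} [Field K]

lemma jacobiSum_eq_zero_of_strictly_increasing {a : ℕ → ℕ → K} {n s : ℕ}
    (h : ∀ i j k, i < j → j < k → k < n → jacobiSum a n i j k s = 0) {i j k : ℕ} (hi : i < n)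
    (hj : j < n) (hk : k < n) : jacobiSum a n i j k s = 0 := by
  have h1 : ∀ i j k, i ≤ j → j ≤ k → k < n → jacobiSum a n i j k s = 0 := by
    intro i j k hij hjk hk
    rcases hij.eq_or_lt with rfl | hij
    · exact jacobiSum_self a n i k s
    · rcases hjk.eq_or_lt with rfl | hjk
      · rw [jacobiSum_rotate, jacobiSum_self]
      · exact h i j k hij hjk hk
  have h2 : ∀ i j k, i ≤ j → i ≤ k → j < n → k < n → jacobiSum a n i j k s = 0 := by
    intro i j k hij hik hj hk
    rcases le_total j k with hjk | hjk
    · exact h1 i j k hij hjk hk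
    · rw [jacobiSum_swap, jacobiSum_rotate, h1 i k j hik hjk hj, neg_zero]
  rcases le_total i j with hij | hij
  · rcases le_total i k with hik | hik
    · exact h2 i j k hij hik hj hk
    · rw [← jacobiSum_rotate]; exact h2 k i j hik (hik.trans hij) hi hj
  · rcases le_total j k with hjk | hjk
    · rw [jacobiSum_rotate]; exact h2 j k i hjk hij hk hi
    · rw [← jacobiSum_rotate]; exact h2 k i j (hjk.trans hij) hjk hi hj

lemma vergnePoint_mem_lieVariety {a : ℕ → ℕ → K}
    (ha : ∀ i k, 1 ≤ i → k < 2 * i + 2 → a i k = 0) (h : JacobiRelations a) :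
    vergnePoint 11 a ∈ lieVariety 11 K := by
  obtain ⟨h1, h2, h3, h4⟩ := h
  rw [vergnePoint_mem_lieVariety_iff]
  intro i hi j hj k hk s hs
  refine jacobiSum_eq_zero_of_strictly_increasing (fun i j k hij hjk hk => ?_) hi hj hk
  rcases Nat.eq_zero_or_pos i with rfl | hi
  · exact jacobiSum_zero_left (fun i k hi hk => ha i k hi (by omega)) (by omega) (by omega) hs
  rcases lt_or_ge s (i + j + k + 2) with hlt | hge
  · exact jacobiSum_eq_zero_of_lt (w := 1) ha 11 hi (by omega) (by omega) (by omega)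
  -- Degree reasons leave only `i + j + k + 2 ≤ s ≤ 10` with `1 ≤ i < j < k`, which is seven cases.
  have : (i = 1 ∧ j = 2 ∧ k = 3 ∧ (s = 8 ∨ s = 9 ∨ s = 10)) ∨
      (i = 1 ∧ j = 2 ∧ k = 4 ∧ (s = 9 ∨ s = 10)) ∨ (i = 1 ∧ j = 2 ∧ k = 5 ∧ s = 10) ∨
      (i = 1 ∧ j = 3 ∧ k = 4 ∧ s = 10) := by omega
  rcases this with ⟨rfl, rfl, rfl, rfl | rfl | rfl⟩ | ⟨rfl, rfl, rfl, rfl | rfl⟩ |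
    ⟨rfl, rfl, rfl, rfl⟩ | ⟨rfl, rfl, rfl, rfl⟩ <;>
  simp [jacobiSum, Finset.sum_range_succ, vergneCoeff, shiftCoeff, ha]
  · linear_combination h1
  · linear_combination h3
  · linear_combination h4
  · linear_combination h1
  · linear_combination h3
  · linear_combination h1 - h2
  · linear_combination h2

/-- The lowest-degree Jacobi sums of `(1,2,3)`, `(1,3,4)`, `(1,4,5)` reduce in turn to nonzero
multiples of the squares of `a 2 5`, `a 3 7`, `a 4 9`. Once these vanish, `[X_1, X_9] = 0` says `a 1
3 = 0`. -/
lemma weight_zero_coeff_eq_zero [CharZero K] {a : ℕ → ℕ → K}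
    (ha : ∀ i k, 1 ≤ i → k < 2 * i + 1 → a i k = 0) (h : vergnePoint 11 a ∈ lieVariety 11 K)
    (h19 : vergneCoeff a 1 9 10 = 0) :
    a 1 3 = 0 ∧ a 2 5 = 0 ∧ a 3 7 = 0 ∧ a 4 9 = 0 := by
  rw [vergnePoint_mem_lieVariety_iff] at h
  have e1 := h 1 (by simp) 2 (by simp) 3 (by simp) 6 (by simp)
  have e2 := h 1 (by simp) 3 (by simp) 4 (by simp) 8 (by simp)
  have e3 := h 1 (by simp) 4 (by simp) 5 (by simp) 10 (by simp)
  simp [jacobiSum, Finset.sum_range_succ, vergneCoeff, shiftCoeff, ha] at e1 e2 e3 h19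
  have h2 : a 2 5 = 0 := pow_eq_zero_iff two_ne_zero |>.mp (by linear_combination e1 / 2)
  rw [h2] at e2 e3 h19
  have h3 : a 3 7 = 0 := pow_eq_zero_iff two_ne_zero |>.mp (by linear_combination -e2 / 3)
  rw [h3] at e3 h19
  have h4 : a 4 9 = 0 := pow_eq_zero_iff two_ne_zero |>.mp (by linear_combination e3 / 4)
  rw [h4] at h19
  exact ⟨by linear_combination h19, h2, h3, h4⟩

lemma jacobiRelations_of_vergnePoint_mem_lieVariety {a : ℕ → ℕ → K}
    (ha : ∀ i k, 1 ≤ i → k < 2 * i + 2 → a i k = 0) (h : vergnePoint 11 a ∈ lieVariety 11 K) :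
    JacobiRelations a := by
  rw [vergnePoint_mem_lieVariety_iff] at h
  have e1 := h 1 (by simp) 2 (by simp) 3 (by simp) 8 (by simp)
  have e2 := h 1 (by simp) 3 (by simp) 4 (by simp) 10 (by simp)
  have e3 := h 1 (by simp) 2 (by simp) 3 (by simp) 9 (by simp)
  have e4 := h 1 (by simp) 2 (by simp) 3 (by simp) 10 (by simp)
  simp [jacobiSum, Finset.sum_range_succ, vergneCoeff, shiftCoeff, ha] at e1 e2 e3 e4
  refine ⟨?_, ?_, ?_, ?_⟩
  · linear_combination e1
  · linear_combination e2
  · linear_combination e3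
  · linear_combination e4

end Jacobi

/-! ### The flag of tails of a basis -/

section Flag

variable {n : ℕ} {K : Type*} [Field K] {L : Type*} [LieRing L] [LieAlgebra K L]
  (v : Module.Basis (Fin n) K L)

/-- The `k`-th vector of a basis indexed by `Fin n`, and `0` for `k ≥ n`. -/
noncomputable def vec (k : ℕ) : L := if h : k < n then v ⟨k, h⟩ else 0

lemma vec_coe (k : Fin n) : vec v k = v k := by simp [vec]

lemma repr_vec (l : ℕ) {m : ℕ} (hm : m < n) :
    v.repr (vec v l) ⟨m, hm⟩ = if l = m then 1 else 0 := by
  rw [vec]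
  split_ifs with h1 h2 h2
  · subst h2; simp
  · rw [v.repr_self, Finsupp.single_eq_of_ne]
    intro h'; exact h2 (Fin.mk.inj h').symm
  · omega
  · simp

lemma vec_of_le {k : ℕ} (h : n ≤ k) : vec v k = 0 := by simp [vec, h]

/-- The span of the vectors of a basis with index at least `m`, described by coordinates. -/
def tailSpan (m : ℕ) : Submodule K L where
  carrier := {x | ∀ k : Fin n, k.1 < m → v.repr x k = 0}
  zero_mem' := by simp
  add_mem' hx hy k hk := by simp [hx k hk, hy k hk]
  smul_mem' r x hx k hk := by simp [hx k hk]

variable {v}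

lemma tailSpan_anti {m m' : ℕ} (h : m ≤ m') : tailSpan v m' ≤ tailSpan v m :=
  fun _ hx k hk => hx k (hk.trans_le h)

variable (v) in
lemma mem_tailSpan_zero (x : L) : x ∈ tailSpan v 0 := fun k hk => absurd hk k.1.not_lt_zero

lemma eq_zero_of_mem_tailSpan {m : ℕ} (h : n ≤ m) {x : L} (hx : x ∈ tailSpan v m) : x = 0 :=
  v.repr.map_eq_zero_iff.mp (Finsupp.ext fun k => hx k (k.2.trans_le h))

variable (v) in
lemma vec_mem_tailSpan {m k : ℕ} (h : m ≤ k) : vec v k ∈ tailSpan v m :=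
  fun l hl => (repr_vec v k l.2).trans (if_neg (by omega))

lemma tailSpan_le {m : ℕ} {N : Submodule K L} (h : ∀ k, m ≤ k → vec v k ∈ N) :
    tailSpan v m ≤ N := by
  intro x hx
  rw [← v.sum_repr x]
  refine N.sum_mem fun k _ => ?_
  rcases lt_or_ge k.1 m with hk | hk
  · rw [hx k hk, zero_smul]; exact N.zero_mem
  · rw [← vec_coe]; exact N.smul_mem _ (h k hk)

lemma exists_smul_vec_add {m : ℕ} {x : L} (hx : x ∈ tailSpan v m) :
    ∃ r : K, ∃ y ∈ tailSpan v (m + 1), x = r • vec v m + y := by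
  by_cases hm : m < n
  · refine ⟨v.repr x ⟨m, hm⟩, x - v.repr x ⟨m, hm⟩ • vec v m, fun k hk => ?_, by abel⟩
    rw [vec, dif_pos hm, map_sub, map_smul, v.repr_self]
    rcases Nat.lt_succ_iff_lt_or_eq.mp hk with h | h
    · have : k ≠ ⟨m, hm⟩ := fun h' => by subst h'; exact absurd h (lt_irrefl _)
      simp [hx k h, this]
    · have : k = ⟨m, hm⟩ := Fin.ext h
      subst this; simp
  · exact ⟨0, x, fun k _ => hx k (by omega), by simp⟩

lemma vec_notMem_tailSpan {m : ℕ} (hm : m < n) : vec v m ∉ tailSpan v (m + 1) := fun h => by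
  have := h ⟨m, hm⟩ (Nat.lt_succ_self m)
  simp [vec, hm] at this

variable (v) in
lemma finrank_tailSpan (m : ℕ) : Module.finrank K (tailSpan v m) = n - m := by
  have h : tailSpan v m = Submodule.span K
      (Set.range (v ∘ ((↑) : {k : Fin n // m ≤ k.1} → Fin n))) := by
    refine le_antisymm (tailSpan_le fun k hk => ?_) (Submodule.span_le.mpr ?_)
    · by_cases h : k < n
      · rw [vec, dif_pos h]; exact Submodule.subset_span ⟨⟨⟨k, h⟩, hk⟩, rfl⟩
      · rw [vec, dif_neg h]; exact Submodule.zero_mem _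
    · rintro _ ⟨k, rfl⟩
      simpa only [vec_coe, Function.comp_apply] using! vec_mem_tailSpan v k.2
  rw [h, finrank_span_eq_card (v.linearIndependent.comp _ Subtype.val_injective),
    Fintype.card_congr
    (⟨fun k => ⟨k.1.1 - m, by omega⟩, fun k => ⟨⟨k.1 + m, by omega⟩, by simp⟩,
      fun k => Subtype.ext (Fin.ext (Nat.sub_add_cancel k.2)), fun k => Fin.ext (by simp)⟩ :
      {k : Fin n // m ≤ k.1} ≃ Fin (n - m)), Fintype.card_fin]

end Flag

/-! ### Vergne bases and the ascending central series -/

section VergneBasis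

variable {n : ℕ} {K : Type*} [Field K] {L : Type*} [LieRing L] [LieAlgebra K L]

/-- A basis in which `[X_0, X_i] = X_{i+1}` for `i ≥ 1` and the products of the other basis vectors
are the ones determined by the coefficients `a i k` of the `[X_i, X_{i+1}]`, which raise the
degree by at least `1`. -/
structure IsVergneBasis (v : Module.Basis (Fin n) K L) (a : ℕ → ℕ → K) : Prop where
  coeff_eq_zero : ∀ i k, 1 ≤ i → k < 2 * i + 2 → a i k = 0
  structureConstants_eq : structureConstants v = vergnePoint n a

variable {v : Module.Basis (Fin n) K L} {a : ℕ → ℕ → K}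

lemma repr_lie_vec (h : structureConstants v = vergnePoint n a) {i j k : ℕ} (hi : i < n)
    (hj : j < n) (hk : k < n) : v.repr ⁅vec v i, vec v j⁆ ⟨k, hk⟩ = vergneCoeff a i j k := by
  rw [vec, dif_pos hi, vec, dif_pos hj]
  exact congrFun h (⟨i, hi⟩, ⟨j, hj⟩, ⟨k, hk⟩)

namespace IsVergneBasis


lemma coeff_eq_zero' (h : IsVergneBasis v a) (i k : ℕ) (hi : 1 ≤ i) (hk : k < 2 * i + 1 + 1) :
    a i k = 0 :=
  h.coeff_eq_zero i k hi hk

lemma ext_vec (v : Module.Basis (Fin n) K L) {x y : L}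
    (hxy : ∀ k (hk : k < n), v.repr x ⟨k, hk⟩ = v.repr y ⟨k, hk⟩) : x = y :=
  v.repr.injective (Finsupp.ext fun k => hxy k k.2)

lemma lie_zero_vec (h : IsVergneBasis v a) {j : ℕ} (hj : 1 ≤ j) :
    ⁅vec v 0, vec v j⁆ = vec v (j + 1) := by
  by_cases hn : j < n
  · refine ext_vec v fun k hk => ?_
    rw [repr_lie_vec h.structureConstants_eq (by omega) hn, vergneCoeff_zero_left a hj, repr_vec]
    exact if_congr eq_comm rfl rfl
  · rw [vec_of_le v (not_lt.mp hn), vec_of_le v (by omega : n ≤ j + 1), lie_zero]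

lemma lie_vec_mem (h : IsVergneBasis v a) {w : ℕ}
    (hw : ∀ i k, 1 ≤ i → k < 2 * i + 1 + w → a i k = 0) {i j : ℕ} (hi : 1 ≤ i) (hj : 1 ≤ j) :
    ⁅vec v i, vec v j⁆ ∈ tailSpan v (i + j + w) := by
  by_cases hin : i < n
  · by_cases hjn : j < n
    · intro k hk
      exact (repr_lie_vec h.structureConstants_eq hin hjn k.2).trans
        (vergneCoeff_eq_zero hw hi hj hk)
    · rw [vec_of_le v (by omega : n ≤ j), lie_zero]; exact Submodule.zero_mem _
  · rw [vec_of_le v (by omega : n ≤ i), zero_lie]; exact Submodule.zero_mem _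

lemma lie_mem_of_vec {i j m : ℕ} (hv : ∀ k l, i ≤ k → j ≤ l → ⁅vec v k, vec v l⁆ ∈ tailSpan v m)
    {x y : L} (hx : x ∈ tailSpan v i) (hy : y ∈ tailSpan v j) : ⁅x, y⁆ ∈ tailSpan v m := by
  have h1 : ∀ k, i ≤ k → tailSpan v j ≤ (tailSpan v m).comap (LieAlgebra.ad K L (vec v k)) :=
    fun k hk => tailSpan_le fun l hl => hv k l hk hl
  have h2 : tailSpan v i ≤ (tailSpan v m).comap (LieAlgebra.ad K L y) := tailSpan_le fun k hk => by
    rw [Submodule.mem_comap, LieAlgebra.ad_apply, ← lie_skew, Submodule.neg_mem_iff]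
    exact h1 k hk hy
  have := h2 hx
  rwa [Submodule.mem_comap, LieAlgebra.ad_apply, ← lie_skew, Submodule.neg_mem_iff] at this

lemma lie_mem (h : IsVergneBasis v a) {w : ℕ}
    (hw : ∀ i k, 1 ≤ i → k < 2 * i + 1 + w → a i k = 0) {i j : ℕ} (hi : 1 ≤ i) (hj : 1 ≤ j)
    {x y : L} (hx : x ∈ tailSpan v i) (hy : y ∈ tailSpan v j) :
    ⁅x, y⁆ ∈ tailSpan v (i + j + w) :=
  lie_mem_of_vec (fun _ _ hk hl => tailSpan_anti (by omega)
    (h.lie_vec_mem hw (hi.trans hk) (hj.trans hl))) hx hy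

lemma lie_mem_succ (h : IsVergneBasis v a) {j : ℕ} (hj : 1 ≤ j) (x : L) {y : L}
    (hy : y ∈ tailSpan v j) : ⁅x, y⁆ ∈ tailSpan v (j + 1) := by
  refine lie_mem_of_vec (fun k l _ hl => ?_) (mem_tailSpan_zero v x) hy
  rcases Nat.eq_zero_or_pos k with rfl | hk
  · rw [h.lie_zero_vec (hj.trans hl)]; exact vec_mem_tailSpan v (by omega)
  · exact tailSpan_anti (by omega) (h.lie_vec_mem h.coeff_eq_zero' hk (hj.trans hl))

lemma lie_mem_two (h : IsVergneBasis v a) (x y : L) : ⁅x, y⁆ ∈ tailSpan v 2 := by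
  refine lie_mem_of_vec (fun k l _ _ => ?_) (mem_tailSpan_zero v x) (mem_tailSpan_zero v y)
  rcases Nat.eq_zero_or_pos l with rfl | hl
  · rcases Nat.eq_zero_or_pos k with rfl | hk
    · rw [lie_self]; exact Submodule.zero_mem _
    · rw [← lie_skew, h.lie_zero_vec hk, Submodule.neg_mem_iff]
      exact vec_mem_tailSpan v (by omega)
  · exact tailSpan_anti (by omega) (h.lie_mem_succ hl _ (vec_mem_tailSpan v le_rfl))

/-- Bracketing with `X_1` excludes an `X_0`-component, since it would produce a multiple of `X_2`.
After that, bracketing with `X_0` shifts indices by one, so the first nonzero coordinate of `x`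
cannot lie below `m - 1`. -/
lemma mem_tailSpan_of_lie_mem (h : IsVergneBasis v a) {m : ℕ} (hm : 3 ≤ m) (hmn : m ≤ n)
    {x : L} (hx : ∀ y : L, ⁅y, x⁆ ∈ tailSpan v m) : x ∈ tailSpan v (m - 1) := by
  obtain ⟨r, y, hy, rfl⟩ := exists_smul_vec_add (mem_tailSpan_zero v x)
  have hr : r = 0 := by
    have h1 := hx (vec v 1)
    rw [lie_add, lie_smul, ← lie_skew, h.lie_zero_vec le_rfl] at h1
    have h2 : ⁅vec v 1, y⁆ ∈ tailSpan v 3 :=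
      h.lie_mem h.coeff_eq_zero' le_rfl le_rfl (vec_mem_tailSpan v le_rfl) hy
    by_contra hr
    apply vec_notMem_tailSpan (v := v) (m := 2) (by omega)
    have h3 := Submodule.sub_mem _ (tailSpan_anti hm h1) h2
    rwa [add_sub_cancel_right, Submodule.smul_mem_iff _ hr, Submodule.neg_mem_iff] at h3
  rw [hr, zero_smul, zero_add] at hx ⊢
  have key : ∀ l, 1 ≤ l → l ≤ m - 1 → y ∈ tailSpan v l := by
    intro l hl
    induction l, hl using Nat.le_induction with
    | base => exact fun _ => hy
    | succ l hl ih =>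
      intro hlm
      obtain ⟨r, z, hz, rfl⟩ := exists_smul_vec_add (ih (by omega))
      by_cases hr : r = 0
      · rwa [hr, zero_smul, zero_add]
      · exfalso
        apply vec_notMem_tailSpan (v := v) (m := l + 1) (by omega)
        have h1 := Submodule.sub_mem _ (tailSpan_anti (by omega : l + 1 + 1 ≤ m) (hx (vec v 0)))
          (h.lie_mem_succ (by omega) (vec v 0) hz)
        rwa [lie_add, add_sub_cancel_right, lie_smul, h.lie_zero_vec hl,
          Submodule.smul_mem_iff _ hr] at h1
  exact key (m - 1) (by omega) le_rfl

/-- The tails from index 2 on are intrinsic to `L`. This gives filiformity, and it lets two Vergne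
bases be compared. -/
lemma mem_ucs_iff (h : IsVergneBasis v a) {i : ℕ} (hi : i + 2 ≤ n) {x : L} :
    x ∈ (⊥ : LieSubmodule K L L).ucs i ↔ x ∈ tailSpan v (n - i) := by
  induction i generalizing x with
  | zero =>
    rw [LieSubmodule.ucs_zero, LieSubmodule.mem_bot]
    exact ⟨fun hx => hx ▸ Submodule.zero_mem _, eq_zero_of_mem_tailSpan le_rfl⟩
  | succ i ih =>
    rw [LieSubmodule.ucs_succ, LieSubmodule.mem_normalizer]
    simp only [ih (by omega)]
    constructor
    · intro hx
      exact h.mem_tailSpan_of_lie_mem (m := n - i) (by omega) (by omega) hx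
    · intro hx y
      have := h.lie_mem_succ (by omega) y hx
      rwa [show n - (i + 1) + 1 = n - i by omega] at this

lemma isFiliform (h : IsVergneBasis v a) (hn : 2 ≤ n) : IsFiliform K L where
  finiteDimensional := Module.Finite.of_basis v
  nilpotent := by
    refine (LieModule.isNilpotent_iff_exists_ucs_eq_top K).mpr ⟨n - 2 + 1, ?_⟩
    rw [eq_top_iff]
    intro x _
    rw [LieSubmodule.ucs_succ, LieSubmodule.mem_normalizer]
    intro y
    rw [h.mem_ucs_iff (by omega), show n - (n - 2) = 2 by omega]
    exact h.lie_mem_two y x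
  finrank_ucs i hi := by
    rw [Module.finrank_eq_card_basis v, Fintype.card_fin] at hi
    have : ((⊥ : LieSubmodule K L L).ucs i).toSubmodule = tailSpan v (n - i) :=
      Submodule.ext fun x => h.mem_ucs_iff (by omega)
    change Module.finrank K ((⊥ : LieSubmodule K L L).ucs i).toSubmodule = i
    rw [this, finrank_tailSpan]
    omega

/-- The tail spans of two Vergne bases agree from index `2` on. -/
lemma mem_tailSpan_iff (h : IsVergneBasis v a) {v' : Module.Basis (Fin n) K L} {a' : ℕ → ℕ → K}
    (h' : IsVergneBasis v' a') {m : ℕ} (hm : 2 ≤ m) {x : L} :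
    x ∈ tailSpan v' m ↔ x ∈ tailSpan v m := by
  rcases le_or_gt n m with hn | hn
  · constructor <;> intro hx <;> rw [eq_zero_of_mem_tailSpan hn hx] <;> exact Submodule.zero_mem _
  · have h1 := h.mem_ucs_iff (i := n - m) (x := x) (by omega)
    have h2 := h'.mem_ucs_iff (i := n - m) (x := x) (by omega)
    rw [show n - (n - m) = m by omega] at h1 h2
    exact h2.symm.trans h1

end IsVergneBasis

lemma vergnePoint_mem_vergneFilSet [CharZero K] {a : ℕ → ℕ → K}
    (ha : ∀ i k, 1 ≤ i → k < 2 * i + 2 → a i k = 0) (h : vergnePoint 11 a ∈ lieVariety 11 K) :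
    vergnePoint 11 a ∈ vergneFilSet 11 K := by
  refine ⟨⟨h, IsVergneBasis.isFiliform (v := AlgebraOf.stdBasis ⟨_, h⟩) (a := a)
    ⟨ha, AlgebraOf.structureConstants_stdBasis _⟩ (by norm_num)⟩, ?_, ?_, ?_⟩
  · intro z i k hz hi _
    simp only [vergnePoint, hz]
    exact vergneCoeff_zero_left a hi k
  · intro i j k hi hj
    exact vergneCoeff_eq_zero (w := 1) (i := i) (j := j) (k := k) ha (by omega) (by omega)
      (by omega)
  · intro i j k hi hj hk
    exact vergneCoeff_eq_zero (w := 1) (i := i) (j := j) (k := k) ha hi hj (by omega)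

end VergneBasis

/-! ### Leading coefficients under a change of Vergne basis -/

section Invariants

variable {n : ℕ} {K : Type*} [Field K] {L : Type*} [LieRing L] [LieAlgebra K L]
  {v v' : Module.Basis (Fin n) K L} {a a' : ℕ → ℕ → K}

namespace IsVergneBasis

/-- The first two vectors of a Vergne basis are determined up to scalars, up to adding to the zeroth
one a multiple of the other one, and modulo `tailSpan v 2`. -/
lemma exists_leading_coeff (hn : 4 ≤ n) (h : IsVergneBasis v a) (h' : IsVergneBasis v' a') :
    ∃ l m : K, l ≠ 0 ∧ m ≠ 0 ∧
      ∀ k, ∃ z ∈ tailSpan v (k + 2), vec v' (k + 1) = (l ^ k * m) • vec v (k + 1) + z := by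
  obtain ⟨l, p, hp, h0⟩ := exists_smul_vec_add (mem_tailSpan_zero v (vec v' 0))
  obtain ⟨e, q, hq, h1⟩ := exists_smul_vec_add (mem_tailSpan_zero v (vec v' 1))
  obtain ⟨m, q', hq', rfl⟩ := exists_smul_vec_add hq
  -- The product of the new `X_1` with the new `X_{n-2}` is zero, because degrees rise by at least
  -- one. An `X_0`-component `e` of the new `X_1` would contribute a nonzero multiple of `e` times
  -- `X_{n-1}`.
  have he : e = 0 := by
    obtain ⟨r, s, hs, hrs⟩ := exists_smul_vec_add
      ((h.mem_tailSpan_iff h' (by omega)).mp (vec_mem_tailSpan v' (le_refl (n - 2))))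
    have hr : r ≠ 0 := by
      rintro rfl
      rw [zero_smul, zero_add] at hrs
      apply vec_notMem_tailSpan (v := v') (m := n - 2) (by omega)
      rw [h.mem_tailSpan_iff h' (by omega), hrs]
      exact hs
    have hzero : ⁅vec v' 1, vec v' (n - 2)⁆ = 0 := eq_zero_of_mem_tailSpan (by omega)
      (h'.lie_vec_mem h'.coeff_eq_zero' le_rfl (by omega : 1 ≤ n - 2))
    have hs0 : ⁅vec v 0, s⁆ = 0 := eq_zero_of_mem_tailSpan (by omega)
      (h.lie_mem_succ (by omega) _ hs)
    have hq0 : ⁅m • vec v 1 + q', vec v' (n - 2)⁆ = 0 := eq_zero_of_mem_tailSpan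
      (by omega : n ≤ 1 + (n - 2) + 1) (h.lie_mem h.coeff_eq_zero' le_rfl (by omega) hq
        ((h.mem_tailSpan_iff h' (by omega)).mp (vec_mem_tailSpan v' le_rfl)))
    rw [h1, add_lie, hq0, add_zero, smul_lie, hrs, lie_add, hs0, add_zero, lie_smul,
      h.lie_zero_vec (by omega), smul_smul] at hzero
    have hne : vec v (n - 2 + 1) ≠ 0 := fun h0 =>
      vec_notMem_tailSpan (v := v) (m := n - 2 + 1) (by omega) (h0 ▸ Submodule.zero_mem _)
    simpa [hne, hr] using hzero
  rw [he, zero_smul, zero_add] at h1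
  have key : ∀ k, ∃ z ∈ tailSpan v (k + 2),
      vec v' (k + 1) = (l ^ k * m) • vec v (k + 1) + z := by
    intro k
    induction k with
    | zero => exact ⟨q', hq', by rw [h1, pow_zero, one_mul]⟩
    | succ k ih =>
      obtain ⟨z, hz, hk⟩ := ih
      refine ⟨⁅vec v' 0, z⁆ + (l ^ k * m) • ⁅p, vec v (k + 1)⁆, Submodule.add_mem _
        (h.lie_mem_succ (by omega) _ hz) (Submodule.smul_mem _ _ ?_), ?_⟩
      · have := h.lie_mem h.coeff_eq_zero' le_rfl (by omega) hp
          (vec_mem_tailSpan v (le_refl (k + 1)))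
        exact tailSpan_anti (by omega) this
      · rw [← h'.lie_zero_vec (by omega), hk, lie_add, lie_smul, h0, add_lie, smul_lie,
          h.lie_zero_vec (by omega), smul_add, smul_smul, pow_succ]
        rw [show l ^ k * m * l = l ^ k * l * m by ring]
        abel
  -- Otherwise the last vector of the new basis would be zero.
  have hlm : l ^ (n - 2) * m ≠ 0 := by
    intro h0
    obtain ⟨z, hz, hk⟩ := key (n - 2)
    apply vec_notMem_tailSpan (v := v') (m := n - 2 + 1) (by omega)
    rw [hk, h0, eq_zero_of_mem_tailSpan (by omega) hz, zero_smul, zero_add]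
    exact Submodule.zero_mem _
  exact ⟨l, m, fun h0 => hlm (by rw [h0, zero_pow (by omega), zero_mul]),
    right_ne_zero_of_mul hlm, key⟩

lemma sub_smul_vec_mem (h : IsVergneBasis v a) {i s : ℕ} (hi : 1 ≤ i) (hs : s < n)
    (hin : i + 1 < n) (hlow : ∀ k < s, a i k = 0) :
    ⁅vec v i, vec v (i + 1)⁆ - a i s • vec v s ∈ tailSpan v (s + 1) := by
  intro k hk
  rw [map_sub, map_smul, Finsupp.sub_apply, Finsupp.smul_apply,
    repr_lie_vec h.structureConstants_eq (by omega) hin k.2, vergneCoeff_succ a hi, vec, dif_pos hs]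
  rcases Nat.lt_succ_iff_lt_or_eq.mp hk with hk | hk
  · rw [hlow _ hk, v.repr_self, Finsupp.single_eq_of_ne, smul_zero, sub_zero]
    intro h'; subst h'; exact lt_irrefl _ hk
  · have : k = ⟨s, hs⟩ := Fin.ext hk
    subst this; simp

/-- How the leading coefficient of `[X_i, X_{i+1}]` depends on the Vergne basis. -/
lemma leading_coeff_eq (h : IsVergneBasis v a) (h' : IsVergneBasis v' a') {l m : K} (hl : l ≠ 0)
    (hm : m ≠ 0)
    (hlm : ∀ k, ∃ z ∈ tailSpan v (k + 2), vec v' (k + 1) = (l ^ k * m) • vec v (k + 1) + z)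
    {i w : ℕ} (hn : 2 * i + 3 + w < n) (hlow : ∀ k < 2 * i + 3 + w, a (i + 1) k = 0)
    (hw : ∀ p q k, 1 ≤ p → 1 ≤ q → 2 * i + 4 ≤ p + q → k ≤ 2 * i + 3 + w →
      vergneCoeff a p q k = 0) :
    a' (i + 1) (2 * i + 3 + w) * l ^ (w + 1) = m * a (i + 1) (2 * i + 3 + w) := by
  obtain ⟨z, hz, hzi⟩ := hlm i
  obtain ⟨y, hy, hyi⟩ := hlm (i + 1)
  obtain ⟨x, hx, hxs⟩ := hlm (2 * i + 2 + w)
  rw [show 2 * i + 2 + w + 1 = 2 * i + 3 + w by omega] at hxs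
  rw [show 2 * i + 2 + w + 2 = 2 * i + 3 + w + 1 by omega] at hx
  set s := 2 * i + 3 + w with hs
  have hvec : ∀ p q, 1 ≤ p → 1 ≤ q → 2 * i + 4 ≤ p + q →
      ⁅vec v p, vec v q⁆ ∈ tailSpan v (s + 1) := by
    intro p q hp hq hpq
    by_cases hpn : p < n
    · by_cases hqn : q < n
      · intro k hk
        exact (repr_lie_vec h.structureConstants_eq hpn hqn k.2).trans
          (hw p q k hp hq hpq (by omega))
      · rw [vec_of_le v (not_lt.mp hqn), lie_zero]; exact Submodule.zero_mem _
    · rw [vec_of_le v (not_lt.mp hpn), zero_lie]; exact Submodule.zero_mem _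
  -- The error terms `y` and `z` only produce brackets of index sum at least `2 * i + 4`, which by
  -- `hw` lie beyond index `s`.
  have h1 : ⁅vec v (i + 1), y⁆ ∈ tailSpan v (s + 1) :=
    lie_mem_of_vec (i := i + 1) (j := i + 3)
      (fun k l hk hl => hvec k l (by omega) (by omega) (by omega)) (vec_mem_tailSpan v le_rfl) hy
  have h2 : ⁅z, vec v' (i + 2)⁆ ∈ tailSpan v (s + 1) :=
    lie_mem_of_vec (i := i + 2) (j := i + 2)
      (fun k l hk hl => hvec k l (by omega) (by omega) (by omega)) hz
      ((h.mem_tailSpan_iff h' (by omega)).mp (vec_mem_tailSpan v' le_rfl))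
  have h3 := h.sub_smul_vec_mem (i := i + 1) (s := s) (by omega) hn (by omega) hlow
  -- Scaling by `l ^ (s - 1) * m`, the leading coefficient of the new `X_s`, expresses the old `X_s`
  -- through the new one without inverses.
  have h4 : (l ^ (s - 1) * m) • ⁅vec v' (i + 1), vec v' (i + 2)⁆
      - (l ^ i * m * (l ^ (i + 1) * m) * a (i + 1) s) • vec v' s ∈ tailSpan v' (s + 1) := by
    rw [h.mem_tailSpan_iff h' (by omega)]
    have : (l ^ (s - 1) * m) • ⁅vec v' (i + 1), vec v' (i + 2)⁆
        - (l ^ i * m * (l ^ (i + 1) * m) * a (i + 1) s) • vec v' s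
        = (l ^ (s - 1) * m) • (l ^ i * m * (l ^ (i + 1) * m)) •
            (⁅vec v (i + 1), vec v (i + 1 + 1)⁆ - a (i + 1) s • vec v s)
          + ((l ^ (s - 1) * m) • (l ^ i * m) • ⁅vec v (i + 1), y⁆
            + (l ^ (s - 1) * m) • ⁅z, vec v' (i + 2)⁆)
          - (l ^ i * m * (l ^ (i + 1) * m) * a (i + 1) s) • x := by
      rw [hzi, add_lie, hyi, hxs, show s - 1 = 2 * i + 2 + w by omega]
      simp only [lie_add, smul_lie, lie_smul]
      module
    rw [this]
    exact Submodule.sub_mem _ (Submodule.add_mem _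
      (Submodule.smul_mem _ _ (Submodule.smul_mem _ _ h3))
      (Submodule.add_mem _ (Submodule.smul_mem _ _ (Submodule.smul_mem _ _ h1))
        (Submodule.smul_mem _ _ h2))) (Submodule.smul_mem _ _ hx)
  have h5 := h4 ⟨s, hn⟩ (Nat.lt_succ_self s)
  rw [map_sub, map_smul, map_smul, Finsupp.sub_apply, Finsupp.smul_apply, Finsupp.smul_apply,
    repr_lie_vec h'.structureConstants_eq (by omega) (by omega) hn, vergneCoeff_succ a' (by omega),
    vec, dif_pos hn, v'.repr_self, Finsupp.single_eq_same, smul_eq_mul, smul_eq_mul, mul_one,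
    show s - 1 = i + (i + 1) + (w + 1) by omega, pow_add, pow_add] at h5
  refine mul_left_cancel₀
    (mul_ne_zero (mul_ne_zero (pow_ne_zero i hl) (pow_ne_zero (i + 1) hl)) hm) ?_
  linear_combination h5

end IsVergneBasis

end Invariants

/-! ### Invariant ratios in weights one, two and three -/

section Dimension11

variable {K : Type*} [Field K] {L : Type*} [LieRing L] [LieAlgebra K L]
  {v v' : Module.Basis (Fin 11) K L} {a a' : ℕ → ℕ → K}

lemma IsVergneBasis.exists_weight_one_eq (h : IsVergneBasis v a) (h' : IsVergneBasis v' a') :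
    ∃ r : K, r ≠ 0 ∧ a' 1 4 = r * a 1 4 ∧ a' 2 6 = r * a 2 6 ∧ a' 3 8 = r * a 3 8 ∧
      a' 4 10 = r * a 4 10 := by
  obtain ⟨l, m, hl, hm, hlm⟩ := h.exists_leading_coeff (by norm_num) h'
  have key : ∀ i, 2 * i + 4 < 11 → a' (i + 1) (2 * i + 4) = m / l ^ 2 * a (i + 1) (2 * i + 4) := by
    intro i hi
    have := h.leading_coeff_eq (i := i) (w := 1) h' hl hm hlm hi
      (fun k hk => h.coeff_eq_zero _ _ (by omega) (by omega))
      (fun p q k hp hq hpq hk => vergneCoeff_eq_zero h.coeff_eq_zero' hp hq (by omega))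
    field_simp
    exact this
  exact ⟨m / l ^ 2, by positivity, key 0 (by norm_num), key 1 (by norm_num), key 2 (by norm_num),
    key 3 (by norm_num)⟩

/-- The coefficients compared have target at most 9, so `a 4 10` may be nonzero: although of weight
one, it does not affect these targets. -/
lemma IsVergneBasis.exists_weight_two_eq (h : IsVergneBasis v a) (h' : IsVergneBasis v' a')
    (h1 : a 1 4 = 0) (h2 : a 2 6 = 0) (h3 : a 3 8 = 0) :
    ∃ r : K, r ≠ 0 ∧ a' 1 5 = r * a 1 5 ∧ a' 2 7 = r * a 2 7 ∧ a' 3 9 = r * a 3 9 := by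
  obtain ⟨l, m, hl, hm, hlm⟩ := h.exists_leading_coeff (by norm_num) h'
  have ha : ∀ i k, 1 ≤ i → k ≤ 9 → k < 2 * i + 1 + 2 → a i k = 0 := by
    intro i k hi hk hik
    rcases lt_or_ge k (2 * i + 2) with h0 | h0
    · exact h.coeff_eq_zero i k hi h0
    · have : (i = 1 ∧ k = 4) ∨ (i = 2 ∧ k = 6) ∨ (i = 3 ∧ k = 8) := by omega
      rcases this with ⟨rfl, rfl⟩ | ⟨rfl, rfl⟩ | ⟨rfl, rfl⟩ <;> assumption
  have key : ∀ i, 2 * i + 5 < 10 → a' (i + 1) (2 * i + 5) = m / l ^ 3 * a (i + 1) (2 * i + 5) := by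
    intro i hi
    have := h.leading_coeff_eq (i := i) (w := 2) h' hl hm hlm (by omega)
      (fun k hk => ha _ _ (by omega) (by omega) (by omega))
      (fun p q k hp hq hpq hk => vergneCoeff_eq_zero_of_le ha hp hq (by omega) (by omega))
    field_simp
    exact this
  exact ⟨m / l ^ 3, by positivity, key 0 (by norm_num), key 1 (by norm_num), key 2 (by norm_num)⟩

lemma IsVergneBasis.exists_weight_three_eq (h : IsVergneBasis v a) (h' : IsVergneBasis v' a')
    (h1 : a 1 4 = 0) (h2 : a 2 6 = 0) (h3 : a 3 8 = 0) (h4 : a 4 10 = 0) (h5 : a 1 5 = 0)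
    (h6 : a 2 7 = 0) (h7 : a 3 9 = 0) :
    ∃ r : K, r ≠ 0 ∧ a' 1 6 = r * a 1 6 ∧ a' 2 8 = r * a 2 8 ∧ a' 3 10 = r * a 3 10 := by
  obtain ⟨l, m, hl, hm, hlm⟩ := h.exists_leading_coeff (by norm_num) h'
  have ha : ∀ i k, 1 ≤ i → k ≤ 10 → k < 2 * i + 1 + 3 → a i k = 0 := by
    intro i k hi hk hik
    rcases lt_or_ge k (2 * i + 2) with h0 | h0
    · exact h.coeff_eq_zero i k hi h0
    · have : (i = 1 ∧ k = 4) ∨ (i = 2 ∧ k = 6) ∨ (i = 3 ∧ k = 8) ∨ (i = 4 ∧ k = 10) ∨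
        (i = 1 ∧ k = 5) ∨ (i = 2 ∧ k = 7) ∨ (i = 3 ∧ k = 9) := by omega
      rcases this with ⟨rfl, rfl⟩ | ⟨rfl, rfl⟩ | ⟨rfl, rfl⟩ | ⟨rfl, rfl⟩ | ⟨rfl, rfl⟩ |
        ⟨rfl, rfl⟩ | ⟨rfl, rfl⟩ <;> assumption
  have key : ∀ i, 2 * i + 6 < 11 → a' (i + 1) (2 * i + 6) = m / l ^ 4 * a (i + 1) (2 * i + 6) := by
    intro i hi
    have := h.leading_coeff_eq (i := i) (w := 3) h' hl hm hlm (by omega)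
      (fun k hk => ha _ _ (by omega) (by omega) (by omega))
      (fun p q k hp hq hpq hk => vergneCoeff_eq_zero_of_le ha hp hq (by omega) (by omega))
    field_simp
    exact this
  exact ⟨m / l ^ 4, by positivity, key 0 (by norm_num), key 1 (by norm_num), key 2 (by norm_num)⟩

end Dimension11

/-! ### Vergne's theorem -/

section Existence

variable {n : ℕ} {K : Type*} [Field K] {L : Type*} [LieRing L] [LieAlgebra K L]

variable (K L) in
/-- The terms of the ascending central series, as subspaces. -/
def ucsSubmodule (i : ℕ) : Submodule K L := ((⊥ : LieSubmodule K L L).ucs i).toSubmodule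

lemma mem_ucsSubmodule_succ {i : ℕ} {x : L} :
    x ∈ ucsSubmodule K L (i + 1) ↔ ∀ y : L, ⁅y, x⁆ ∈ ucsSubmodule K L i := by
  change x ∈ (⊥ : LieSubmodule K L L).ucs (i + 1)
    ↔ ∀ y : L, ⁅y, x⁆ ∈ (⊥ : LieSubmodule K L L).ucs i
  rw [LieSubmodule.ucs_succ, LieSubmodule.mem_normalizer]

lemma lie_mem_ucsSubmodule {i : ℕ} {x : L} (hx : x ∈ ucsSubmodule K L (i + 1)) (y : L) :
    ⁅y, x⁆ ∈ ucsSubmodule K L i := mem_ucsSubmodule_succ.mp hx y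

lemma mem_ucsSubmodule_zero {x : L} : x ∈ ucsSubmodule K L 0 ↔ x = 0 := by
  change x ∈ (⊥ : LieSubmodule K L L).ucs 0 ↔ x = 0
  rw [LieSubmodule.ucs_zero, LieSubmodule.mem_bot]

lemma ucsSubmodule_le_succ (i : ℕ) : ucsSubmodule K L i ≤ ucsSubmodule K L (i + 1) :=
  fun _ hx => mem_ucsSubmodule_succ.mpr fun _ =>
    LieSubmodule.lie_mem ((⊥ : LieSubmodule K L L).ucs i) hx

lemma ucsSubmodule_mono : Monotone (ucsSubmodule K L) := 
  monotone_nat_of_le_succ ucsSubmodule_le_succ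

/-- A vector of `U` outside a hyperplane `W` of `U` spans `U` together with `W`. -/
lemma exists_smul_add_of_finrank {U W : Submodule K L} [Module.Finite K U]
    (hWU : W ≤ U) (hrank : Module.finrank K U ≤ Module.finrank K W + 1) {u : L} (hu : u ∈ U)
    (huW : u ∉ W) {x : L} (hx : x ∈ U) : ∃ r : K, ∃ y ∈ W, x = r • u + y := by
  have : W ⊔ K ∙ u = U := by
    have hle : W ⊔ K ∙ u ≤ U := sup_le hWU (by simpa using hu)
    have : Module.Finite K (W ⊔ K ∙ u : Submodule K L) :=
      Module.Finite.of_injective _ (Submodule.inclusion_injective hle)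
    refine Submodule.eq_of_le_of_finrank_le hle (hrank.trans ?_)
    refine Submodule.finrank_lt_finrank_of_lt (lt_of_le_of_ne le_sup_left fun h => huW ?_)
    rw [h]; exact Submodule.mem_sup_right (Submodule.mem_span_singleton_self u)
  rw [← this, Submodule.mem_sup] at hx
  obtain ⟨y, hy, z, hz, rfl⟩ := hx
  obtain ⟨r, rfl⟩ := Submodule.mem_span_singleton.mp hz
  exact ⟨r, y, hy, add_comm _ _⟩

namespace IsFiliform

lemma finrank_ucsSubmodule (h : IsFiliform K L) (hn : Module.finrank K L = n) {i : ℕ}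
    (hi : i + 2 ≤ n) : Module.finrank K (ucsSubmodule K L i) = i :=
  h.finrank_ucs i (by omega)

lemma exists_smul_add_of_notMem (h : IsFiliform K L) (hn : Module.finrank K L = n) {i : ℕ}
    (hi : i + 3 ≤ n) {u : L} (hu : u ∈ ucsSubmodule K L (i + 1)) (hui : u ∉ ucsSubmodule K L i)
    {x : L} (hx : x ∈ ucsSubmodule K L (i + 1)) :
    ∃ r : K, ∃ y ∈ ucsSubmodule K L i, x = r • u + y := by
  have := h.finiteDimensional
  refine exists_smul_add_of_finrank (ucsSubmodule_le_succ i) ?_ hu hui hx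
  rw [h.finrank_ucsSubmodule hn (by omega), h.finrank_ucsSubmodule hn (by omega)]

/-- Nilpotency makes `C_{n+1}` strictly larger than `C_n`, hence of codimension at most one. Thus
`L` is `C_{n+1}` plus at most one line, whose self-bracket is zero, and `[L, C_{n+1}] ⊆ C_n`. -/
lemma lie_mem_ucs (h : IsFiliform K L) (hn : Module.finrank K L = n + 2) (x y : L) :
    ⁅x, y⁆ ∈ ucsSubmodule K L n := by
  have := h.finiteDimensional
  have hrank := h.finrank_ucsSubmodule hn (i := n) le_rfl
  have hlt : ucsSubmodule K L n < ucsSubmodule K L (n + 1) := by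
    refine lt_of_le_of_ne (ucsSubmodule_le_succ n) fun heq => ?_
    have hstab : ∀ j, ucsSubmodule K L (n + j) = ucsSubmodule K L n := by
      intro j
      induction j with
      | zero => rfl
      | succ j ih =>
        ext x
        rw [← add_assoc, mem_ucsSubmodule_succ, ih, ← mem_ucsSubmodule_succ, ← heq]
    obtain ⟨k, hk⟩ := (LieModule.isNilpotent_iff_exists_ucs_eq_top K).mp h.nilpotent
    have htop : ucsSubmodule K L n = ⊤ := by
      rw [← hstab k, eq_top_iff]
      refine le_trans ?_ (ucsSubmodule_mono (Nat.le_add_left k n))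
      rw [ucsSubmodule, hk]
      exact fun _ _ => trivial
    rw [htop, finrank_top] at hrank
    omega
  by_cases htop : ucsSubmodule K L (n + 1) = ⊤
  · exact lie_mem_ucsSubmodule (htop ▸ Submodule.mem_top) x
  obtain ⟨u, -, hu⟩ := SetLike.exists_of_lt (lt_top_iff_ne_top.mpr htop)
  have hdec : ∀ x : L, ∃ r : K, ∃ y ∈ ucsSubmodule K L (n + 1), x = r • u + y := fun x => by
    refine exists_smul_add_of_finrank le_top ?_ Submodule.mem_top hu Submodule.mem_top
    have := Submodule.finrank_lt_finrank_of_lt hlt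
    rw [finrank_top]; omega
  obtain ⟨r, y', hy', rfl⟩ := hdec y
  obtain ⟨s, x', hx', rfl⟩ := hdec x
  rw [lie_add, lie_smul, add_lie, smul_lie, lie_self, smul_zero, zero_add, ← lie_skew]
  exact Submodule.add_mem _ (Submodule.smul_mem _ _ (Submodule.neg_mem _
    (lie_mem_ucsSubmodule hx' _))) (lie_mem_ucsSubmodule hy' _)

/-- There is a vector outside the last proper term of the ascending central series whose adjoint
action is nonzero on all its successive quotients. -/
lemma exists_generic [Infinite K] (h : IsFiliform K L) (hn : Module.finrank K L = n + 2) :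
    ∃ x : L, x ∉ ucsSubmodule K L n ∧
      ∀ j, j + 2 ≤ n → ∃ z ∈ ucsSubmodule K L (j + 2), ⁅x, z⁆ ∉ ucsSubmodule K L j := by
  have := h.finiteDimensional
  -- The subspaces to avoid: `C_n`, and for each `j` the vectors whose adjoint action sends
  -- `C_{j+2}` into `C_j`. Each is proper by dimension, and over an infinite field finitely many
  -- proper subspaces do not cover `L`.
  let p : Option (Fin (n - 1)) → Submodule K L := fun j => j.elim (ucsSubmodule K L n) fun j =>
    ⨅ z : ucsSubmodule K L (j + 2), (ucsSubmodule K L j).comap (LieAlgebra.ad K L z)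
  obtain ⟨x, hx⟩ := Submodule.exists_forall_notMem_of_forall_ne_top p (by
    rintro (_ | j) hj
    · have := h.finrank_ucsSubmodule hn (i := n) le_rfl
      rw [show ucsSubmodule K L n = ⊤ from hj, finrank_top] at this
      omega
    have hle : ucsSubmodule K L (j + 2) ≤ ucsSubmodule K L (j + 1) := by
      intro z hz
      rw [mem_ucsSubmodule_succ]
      intro y
      have hy : y ∈ p (some j) := hj ▸ Submodule.mem_top
      rw [← lie_skew, Submodule.neg_mem_iff]
      exact (Submodule.mem_iInf _).mp hy ⟨z, hz⟩
    have := Submodule.finrank_mono hle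
    rw [h.finrank_ucsSubmodule hn (by omega), h.finrank_ucsSubmodule hn (by omega)] at this
    omega)
  refine ⟨x, hx none, fun j hj => ?_⟩
  have := hx (some ⟨j, by omega⟩)
  simp only [p, Option.elim_some, Submodule.mem_iInf, not_forall] at this
  obtain ⟨⟨z, hz⟩, hzx⟩ := this
  refine ⟨z, hz, fun hxz => hzx ?_⟩
  rw [Submodule.mem_comap, LieAlgebra.ad_apply, ← lie_skew, Submodule.neg_mem_iff]
  exact hxz

/-- The vectors `X_0, X_1, [X_0, X_1], [X_0, [X_0, X_1]], …`. -/
def chain (x₀ x₁ : L) : ℕ → L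
  | 0 => x₀
  | 1 => x₁
  | k + 2 => ⁅x₀, chain x₀ x₁ (k + 1)⁆

lemma lie_chain (x₀ x₁ : L) {k : ℕ} (hk : 1 ≤ k) : ⁅x₀, chain x₀ x₁ k⁆ = chain x₀ x₁ (k + 1) := by
  obtain ⟨k, rfl⟩ := Nat.exists_eq_add_of_le' hk
  rfl

/-- Generators of a filiform Lie algebra whose iterated products are adapted to the ascending
central series. -/
lemma exists_chain [Infinite K] (h : IsFiliform K L) (hn : Module.finrank K L = n + 2)
    (hn2 : 2 ≤ n) :
    ∃ x₀ x₁ : L, x₀ ∉ ucsSubmodule K L n ∧ x₁ ∉ ucsSubmodule K L n ⊔ K ∙ x₀ ∧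
      (∀ z ∈ ucsSubmodule K L 2, ⁅x₁, z⁆ = 0) ∧
      ∀ k, k ≤ n → chain x₀ x₁ (k + 2) ∈ ucsSubmodule K L (n - k) ∧
        (k < n → chain x₀ x₁ (k + 2) ∉ ucsSubmodule K L (n - k - 1)) := by
  have := h.finiteDimensional
  obtain ⟨x₀, hx₀n, hx₀⟩ := h.exists_generic hn
  have hrank : Module.finrank K (ucsSubmodule K L n ⊔ K ∙ x₀ : Submodule K L) < n + 2 := by
    have := Submodule.finrank_add_le_finrank_add_finrank (ucsSubmodule K L n) (K ∙ x₀)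
    have h1 : Module.finrank K (K ∙ x₀) ≤ 1 := finrank_span_le_card {x₀} |>.trans (by simp)
    rw [h.finrank_ucsSubmodule hn le_rfl] at this
    omega
  obtain ⟨y, -, hy⟩ := SetLike.exists_of_lt (lt_top_iff_ne_top.mpr fun htop => by
    rw [htop, finrank_top, hn] at hrank; exact lt_irrefl _ hrank :
      (ucsSubmodule K L n ⊔ K ∙ x₀ : Submodule K L) < ⊤)
  obtain ⟨u, hu, hxu⟩ := hx₀ 0 (by omega)
  have hu1 : u ∉ ucsSubmodule K L 1 := fun h1 => hxu (lie_mem_ucsSubmodule h1 _)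
  obtain ⟨c, w, hw, hc⟩ := h.exists_smul_add_of_notMem hn (by omega)
    (lie_mem_ucsSubmodule hu x₀) hxu (lie_mem_ucsSubmodule hu y)
  rw [mem_ucsSubmodule_zero.mp hw, add_zero] at hc
  -- `C_1` is a line, so `[y, u] = c [x₀, u]` for some `c`. Subtracting `c • x₀` makes the bracket
  -- with `u` vanish, and `u` spans `C_2` modulo the centre.
  set x₁ := y - c • x₀ with hx₁
  have hspan : x₁ ∉ ucsSubmodule K L n ⊔ K ∙ x₀ := fun h1 => hy <| by
    have h2 : c • x₀ ∈ ucsSubmodule K L n ⊔ K ∙ x₀ := Submodule.smul_mem _ _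
      (Submodule.mem_sup_right (Submodule.mem_span_singleton_self x₀))
    simpa [hx₁] using Submodule.add_mem _ h1 h2
  have hcomm : ∀ z ∈ ucsSubmodule K L 2, ⁅x₁, z⁆ = 0 := by
    intro z hz
    obtain ⟨r, t, ht, rfl⟩ := h.exists_smul_add_of_notMem hn (by omega) hu hu1 hz
    rw [lie_add, lie_smul, mem_ucsSubmodule_zero.mp (lie_mem_ucsSubmodule ht x₁), hx₁, sub_lie,
      smul_lie, hc, sub_self, smul_zero, add_zero]
  have hdec : ∀ x : L, ∃ r : K, ∃ y ∈ ucsSubmodule K L n ⊔ K ∙ x₀, x = r • x₁ + y := fun x => by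
    refine exists_smul_add_of_finrank le_top ?_ Submodule.mem_top hspan Submodule.mem_top
    have hlt : ucsSubmodule K L n < ucsSubmodule K L n ⊔ K ∙ x₀ :=
      lt_of_le_of_ne le_sup_left fun heq => hx₀n <| by
        rw [heq]; exact Submodule.mem_sup_right (Submodule.mem_span_singleton_self x₀)
    have := Submodule.finrank_lt_finrank_of_lt hlt
    rw [h.finrank_ucsSubmodule hn le_rfl] at this
    rw [finrank_top, hn]
    omega
  refine ⟨x₀, x₁, hx₀n, hspan, hcomm, fun k => ?_⟩
  induction k with
  | zero =>
    -- If `[x₀, x₁]` were in `C_{n-1}`, then `x₁` would be in `C_n`, because `x₀`, `x₁` and `C_n`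
    -- span `L`.
    refine fun _ => ⟨h.lie_mem_ucs hn _ _, fun _ hmem => hspan (Submodule.mem_sup_left ?_)⟩
    rw [show n = n - 0 - 1 + 1 by omega, mem_ucsSubmodule_succ]
    intro x
    obtain ⟨r, y, hy, rfl⟩ := hdec x
    obtain ⟨z, hz, t, ht, rfl⟩ := Submodule.mem_sup.mp hy
    obtain ⟨s, rfl⟩ := Submodule.mem_span_singleton.mp ht
    rw [add_lie, smul_lie, lie_self, smul_zero, zero_add, add_lie, smul_lie]
    refine Submodule.add_mem _ ?_ (Submodule.smul_mem _ _ hmem)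
    rw [← lie_skew, Submodule.neg_mem_iff]
    rw [show n = n - 0 - 1 + 1 by omega] at hz
    exact lie_mem_ucsSubmodule hz _
  | succ k ih =>
    intro hk
    obtain ⟨h1, h2⟩ := ih (by omega)
    have h2 := h2 (by omega)
    rw [show n - k = n - (k + 1) + 1 by omega] at h1
    rw [show n - k - 1 = n - (k + 1) by omega] at h2
    refine ⟨lie_mem_ucsSubmodule h1 _, fun hkn hmem => ?_⟩
    -- If the next chain vector dropped by two terms of the series, so would the image under `ad x₀`
    -- of the whole term spanned by the current vector and the previous term, against the choice of
    -- `x₀`.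
    obtain ⟨z, hz, hxz⟩ := hx₀ (n - (k + 1) - 1) (by omega)
    rw [show n - (k + 1) - 1 + 2 = n - (k + 1) + 1 by omega] at hz
    obtain ⟨r, t, ht, rfl⟩ := h.exists_smul_add_of_notMem hn (by omega) h1 h2 hz
    rw [lie_add, lie_smul] at hxz
    rw [show n - (k + 1) = n - (k + 1) - 1 + 1 by omega] at ht
    exact hxz (Submodule.add_mem _ (Submodule.smul_mem _ _ hmem) (lie_mem_ucsSubmodule ht _))

/-- Vergne's theorem: a filiform Lie algebra has a basis `X_0, X_1, …` with `[X_0, X_i] = X_{i+1}`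
for `i ≥ 1`, `[X_1, X_n] = 0` and `[X_i, X_j]` in the span of the `X_k`, `k ≥ i + j`, where `n + 2`
is the dimension. -/
lemma exists_vergneBasis [Infinite K] (h : IsFiliform K L) (hn : Module.finrank K L = n + 2)
    (hn2 : 2 ≤ n) : ∃ v : Module.Basis (Fin (n + 2)) K L,
      (∀ j, 1 ≤ j → ⁅vec v 0, vec v j⁆ = vec v (j + 1)) ∧ ⁅vec v 1, vec v n⁆ = 0 ∧
      ∀ i j, 1 ≤ i → 1 ≤ j → ⁅vec v i, vec v j⁆ ∈ tailSpan v (i + j) := by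
  have := h.finiteDimensional
  obtain ⟨x₀, x₁, hx₀, hx₁, hcomm, hX⟩ := h.exists_chain hn hn2
  set X := chain x₀ x₁ with hXdef
  have hzero : ∀ k, n + 2 ≤ k → X k = 0 := by
    intro k hk
    induction k, hk using Nat.le_induction with
    | base => simpa [mem_ucsSubmodule_zero] using (hX n le_rfl).1
    | succ k hk ih => rw [hXdef, ← lie_chain x₀ x₁ (by omega), ← hXdef, ih, lie_zero]
  have hle : ∀ N : Submodule K L, ∀ i ≤ n, (∀ k, n + 2 - i ≤ k → X k ∈ N) →
      ucsSubmodule K L i ≤ N := by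
    intro N i
    induction i with
    | zero => exact fun _ _ x hx => (mem_ucsSubmodule_zero.mp hx) ▸ N.zero_mem
    | succ i ih =>
      intro hi hN x hx
      have hk := hX (n - (i + 1)) (by omega)
      rw [show n - (n - (i + 1)) = i + 1 by omega, Nat.add_sub_cancel] at hk
      obtain ⟨r, y, hy, rfl⟩ := h.exists_smul_add_of_notMem hn (by omega) hk.1
        (hk.2 (by omega)) hx
      exact N.add_mem (N.smul_mem _ (hN _ (by omega)))
        (ih (by omega) (fun k hk => hN k (by omega)) hy)
  have hspan : ⊤ ≤ Submodule.span K (Set.range fun k : Fin (n + 2) => X k) := by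
    have hmem : ∀ k, X k ∈ Submodule.span K (Set.range fun k : Fin (n + 2) => X k) := by
      intro k
      rcases lt_or_ge k (n + 2) with hk | hk
      · exact Submodule.subset_span ⟨⟨k, hk⟩, rfl⟩
      · rw [hzero k hk]; exact Submodule.zero_mem _
    intro x _
    have hsub : ucsSubmodule K L n ⊔ K ∙ x₀ ≤
        Submodule.span K (Set.range fun k : Fin (n + 2) => X k) :=
      sup_le (hle _ n le_rfl fun k _ => hmem k)
        ((Submodule.span_singleton_le_iff_mem _ _).mpr (hmem 0))
    have hlt : ucsSubmodule K L n < ucsSubmodule K L n ⊔ K ∙ x₀ :=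
      lt_of_le_of_ne le_sup_left fun heq => hx₀ <| by
        rw [heq]; exact Submodule.mem_sup_right (Submodule.mem_span_singleton_self x₀)
    have := Submodule.finrank_lt_finrank_of_lt hlt
    rw [h.finrank_ucsSubmodule hn le_rfl] at this
    obtain ⟨r, y, hy, rfl⟩ := exists_smul_add_of_finrank (U := ⊤) le_top
      (by rw [finrank_top, hn]; omega) Submodule.mem_top hx₁ (Submodule.mem_top (x := x))
    exact Submodule.add_mem _ (Submodule.smul_mem _ _ (hmem 1)) (hsub hy)
  let v := basisOfTopLeSpanOfCardEqFinrank (fun k : Fin (n + 2) => X k) hspan (by simp [hn])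
  have hv : ∀ k, vec v k = X k := by
    intro k
    rcases lt_or_ge k (n + 2) with hk | hk
    · rw [vec, dif_pos hk]; simp [v]
    · rw [vec_of_le v hk, hzero k hk]
  have hucs : ∀ k, 2 ≤ k → X k ∈ ucsSubmodule K L (n + 2 - k) := by
    intro k hk
    rcases le_or_gt k (n + 2) with hkn | hkn
    · have := (hX (k - 2) (by omega)).1
      rwa [show k - 2 + 2 = k by omega, show n - (k - 2) = n + 2 - k by omega] at this
    · rw [hzero k hkn.le]; exact Submodule.zero_mem _
  have hstep : ∀ m (x y : L), y ∈ ucsSubmodule K L (n + 2 - m) →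
      ⁅x, y⁆ ∈ ucsSubmodule K L (n + 2 - (m + 1)) := by
    intro m x y hy
    rcases Nat.lt_or_ge m (n + 2) with hm | hm
    · rw [show n + 2 - m = n + 2 - (m + 1) + 1 by omega] at hy
      exact lie_mem_ucsSubmodule hy x
    · rw [show n + 2 - m = 0 by omega, mem_ucsSubmodule_zero] at hy
      rw [hy, lie_zero]; exact Submodule.zero_mem _
  -- Induction on `i`, for all `j`, from `[X_{i+1}, X_j] = [X_0, [X_i, X_j]] - [X_i, X_{j+1}]`.
  have hlie : ∀ i j, 1 ≤ i → 1 ≤ j → ⁅X i, X j⁆ ∈ ucsSubmodule K L (n + 2 - (i + j)) := by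
    intro i j hi
    induction i, hi using Nat.le_induction generalizing j with
    | base =>
      intro hj
      rcases hj.eq_or_lt with rfl | hj
      · rw [lie_self]; exact Submodule.zero_mem _
      · rw [add_comm 1 j]; exact hstep j _ _ (hucs j hj)
    | succ i hi ih =>
      intro hj
      rw [hXdef, ← lie_chain x₀ x₁ hi, lie_lie, lie_chain x₀ x₁ hj, ← hXdef]
      refine Submodule.sub_mem _ ?_ ?_
      · rw [show i + 1 + j = i + j + 1 by omega]; exact hstep _ _ _ (ih j hj)
      · rw [show i + 1 + j = i + (j + 1) by omega]; exact ih (j + 1) (by omega)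
  refine ⟨v, fun j hj => ?_, ?_, fun i j hi hj => ?_⟩
  · rw [hv, hv, hv]; exact lie_chain x₀ x₁ hj
  · rw [hv, hv]
    refine hcomm _ ?_
    have := hucs n hn2
    rwa [show n + 2 - n = 2 by omega] at this
  · rw [hv, hv]
    refine hle (tailSpan v (i + j)) (n + 2 - (i + j)) (by omega) (fun k hk => ?_) (hlie i j hi hj)
    rcases lt_or_ge k (n + 2) with hkn | hkn
    · rw [← hv]
      exact vec_mem_tailSpan v (by omega)
    · rw [hzero k hkn]; exact Submodule.zero_mem _

end IsFiliform

/-- A basis satisfying the relations of a Vergne basis has the structure constants determined by the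
coefficients of the `[X_i, X_{i+1}]`. -/
lemma exists_structureConstants_eq {v : Module.Basis (Fin n) K L}
    (h0 : ∀ j, 1 ≤ j → ⁅vec v 0, vec v j⁆ = vec v (j + 1))
    (hv : ∀ i j, 1 ≤ i → 1 ≤ j → ⁅vec v i, vec v j⁆ ∈ tailSpan v (i + j)) :
    ∃ a : ℕ → ℕ → K, (∀ i k, 1 ≤ i → k < 2 * i + 1 → a i k = 0) ∧ (∀ i k, n ≤ k → a i k = 0) ∧
      structureConstants v = vergnePoint n a := by
  set f : ℕ → ℕ → ℕ → K := fun i j k =>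
    if hk : k < n then v.repr ⁅vec v i, vec v j⁆ ⟨k, hk⟩ else 0 with hf
  have hf0 : ∀ j k, 1 ≤ j → k < n → f 0 j k = if k = j + 1 then 1 else 0 := by
    intro j k hj hk
    simp only [hf, dif_pos hk, h0 j hj, repr_vec]
    exact if_congr eq_comm rfl rfl
  have hfskew : ∀ i j k, f i j k = -f j i k := by
    intro i j k
    simp only [hf]
    split_ifs with hk
    · rw [← lie_skew, map_neg, Finsupp.neg_apply]
    · simp
  have hfself : ∀ i k, f i i k = 0 := fun i k => by simp [hf]
  have hshift : ∀ z ∈ tailSpan v 1, ∀ k (hk : k < n),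
      v.repr ⁅vec v 0, z⁆ ⟨k, hk⟩ = v.repr z ⟨k - 1, by omega⟩ := by
    intro z hz k hk
    have hle : tailSpan v 1 ≤ LinearMap.ker ((v.coord ⟨k, hk⟩ ∘ₗ
        (LieAlgebra.ad K L (vec v 0) : L →ₗ[K] L)) - v.coord ⟨k - 1, by omega⟩) := by
      refine tailSpan_le fun l hl => ?_
      rw [LinearMap.mem_ker, LinearMap.sub_apply, LinearMap.comp_apply, LieAlgebra.ad_apply,
        h0 l hl, sub_eq_zero, v.coord_apply, v.coord_apply]
      rw [repr_vec, repr_vec]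
      exact if_congr (by omega) rfl rfl
    exact sub_eq_zero.mp (hle hz)
  have hrec : ∀ i j k, 1 ≤ i → 1 ≤ j → k < n →
      f i (j + 1) k = f i j (k - 1) - f (i + 1) j k := by
    intro i j k hi hj hk
    have hz := tailSpan_anti (by omega : 1 ≤ i + j) (hv i j hi hj)
    simp only [hf, dif_pos hk, dif_pos (by omega : k - 1 < n)]
    rw [← hshift _ hz k hk, ← h0 j hj, ← h0 i hi, leibniz_lie (vec v 0), map_add,
      Finsupp.add_apply, add_sub_cancel_left]
  -- Two consecutive differences are carried along because the recursion for `shiftCoeff` goes back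
  -- two steps.
  have key : ∀ d i k, 1 ≤ i → k < n → f i (i + d) k = shiftCoeff (fun i k => f i (i + 1) k) d i k
      ∧ f i (i + d + 1) k = shiftCoeff (fun i k => f i (i + 1) k) (d + 1) i k := by
    intro d
    induction d with
    | zero => exact fun i k _ _ => ⟨hfself i k, rfl⟩
    | succ d ih =>
      refine fun i k hi hk => ⟨(ih i k hi hk).2, ?_⟩
      rw [shiftCoeff, hrec i _ k hi (by omega) hk, ← (ih i (k - 1) hi (by omega)).2,
        ← (ih (i + 1) k (by omega) hk).1]
      rw [show i + (d + 1) = i + d + 1 by omega, show i + 1 + d = i + d + 1 by omega]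
  have hlt : ∀ i j k, 1 ≤ i → i ≤ j → k < n →
      f i j k = shiftCoeff (fun i k => f i (i + 1) k) (j - i) i k := by
    intro i j k hi hij hk
    rw [← (key (j - i) i k hi hk).1, Nat.add_sub_cancel' hij]
  refine ⟨fun i k => f i (i + 1) k, fun i k hi hk => ?_, fun i k hk => ?_, funext fun p => ?_⟩
  · by_cases hkn : k < n
    · simp only [hf, dif_pos hkn]
      exact hv i (i + 1) hi (by omega) ⟨k, hkn⟩ (by simp only; omega)
    · simp [hf, hkn]
  · simp [hf, not_lt.mpr hk]
  · obtain ⟨i, j, k⟩ := p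
    have hfp : structureConstants v (i, j, k) = f i j k := by
      simp [hf, structureConstants, vec_coe]
    rw [hfp, vergnePoint, vergneCoeff]
    simp only
    split_ifs with h1 h2 h2 h3 h3
    · rw [h1, hf0 _ _ h2.1 k.2, if_pos h2.2]
    · rcases Nat.eq_zero_or_pos j.1 with h3 | h3
      · rw [h1, h3, hfself]
      · rw [h1, hf0 _ _ h3 k.2, if_neg fun h4 => h2 ⟨h3, h4⟩]
    · rw [h2, hfskew, hf0 _ _ (by omega) k.2, if_pos h3]
    · rw [h2, hfskew, hf0 _ _ (by omega) k.2, if_neg h3, neg_zero]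
    · exact hlt _ _ _ (by omega) h3 k.2
    · rw [hfskew, hlt _ _ _ (by omega) (by omega) k.2]

/-- A filiform Lie algebra of dimension `11` has a basis in which the products of the basis vectors
other than `X_0` raise the degree. -/
lemma IsFiliform.exists_isVergneBasis [CharZero K] (h : IsFiliform K L)
    (hn : Module.finrank K L = 11) :
    ∃ (v : Module.Basis (Fin 11) K L) (a : ℕ → ℕ → K), IsVergneBasis v a := by
  obtain ⟨v, h0, h1, hv⟩ := h.exists_vergneBasis (n := 9) hn (by norm_num)
  obtain ⟨a, ha, hak, hva⟩ := exists_structureConstants_eq h0 hv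
  have h19 : vergneCoeff a 1 9 10 = 0 := by
    rw [← repr_lie_vec hva (by norm_num) (by norm_num) (by norm_num : 10 < 9 + 2), h1]
    simp
  obtain ⟨e1, e2, e3, e4⟩ := weight_zero_coeff_eq_zero ha
    (hva ▸ structureConstants_mem_lieVariety v) h19
  refine ⟨v, a, fun i k hi hk => ?_, hva⟩
  rcases lt_or_ge k (2 * i + 1) with hk' | hk'
  · exact ha i k hi hk'
  rcases le_or_gt 11 k with hk11 | hk11
  · exact hak i k hk11
  · have : (i = 1 ∧ k = 3) ∨ (i = 2 ∧ k = 5) ∨ (i = 3 ∧ k = 7) ∨ (i = 4 ∧ k = 9) := by omega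
    rcases this with ⟨rfl, rfl⟩ | ⟨rfl, rfl⟩ | ⟨rfl, rfl⟩ | ⟨rfl, rfl⟩ <;> assumption

end Existence

/-! ### Rational functions regular at zero -/

section Regular

open Filter

variable {K : Type*} [Field K]

/-- A function of one variable that is a quotient of polynomials with denominator nonzero at `0`. -/
@[fun_prop]
def RegularAtZero (f : K → K) : Prop :=
  ∃ p q : Polynomial K, q.eval 0 ≠ 0 ∧ ∀ t, q.eval t * f t = p.eval t

namespace RegularAtZero

@[fun_prop]
lemma const (c : K) : RegularAtZero fun _ : K => c := ⟨.C c, 1, by simp, by simp⟩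

@[fun_prop]
lemma id : RegularAtZero fun t : K => t := ⟨.X, 1, by simp, by simp⟩

variable {f g : K → K}

@[fun_prop]
lemma add (hf : RegularAtZero f) (hg : RegularAtZero g) : RegularAtZero fun t => f t + g t := by
  obtain ⟨p, q, hq, h⟩ := hf
  obtain ⟨p', q', hq', h'⟩ := hg
  refine ⟨p * q' + p' * q, q * q', by simp [hq, hq'], fun t => ?_⟩
  simp only [Polynomial.eval_add, Polynomial.eval_mul, ← h, ← h']
  ring

@[fun_prop]
lemma mul (hf : RegularAtZero f) (hg : RegularAtZero g) : RegularAtZero fun t => f t * g t := by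
  obtain ⟨p, q, hq, h⟩ := hf
  obtain ⟨p', q', hq', h'⟩ := hg
  refine ⟨p * p', q * q', by simp [hq, hq'], fun t => ?_⟩
  simp only [Polynomial.eval_mul, ← h, ← h']
  ring

@[fun_prop]
lemma neg (hf : RegularAtZero f) : RegularAtZero fun t => -f t := by
  simpa using (const (-1)).mul hf

@[fun_prop]
lemma sub (hf : RegularAtZero f) (hg : RegularAtZero g) : RegularAtZero fun t => f t - g t := by
  simpa only [sub_eq_add_neg] using hf.add hg.neg

@[fun_prop]
lemma pow (hf : RegularAtZero f) (n : ℕ) : RegularAtZero fun t => f t ^ n := by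
  induction n with
  | zero => simpa using const 1
  | succ n ih => simpa only [pow_succ] using ih.mul hf

lemma div (hf : RegularAtZero f) (hg : RegularAtZero g) (h0 : g 0 ≠ 0) :
    RegularAtZero fun t => f t / g t := by
  obtain ⟨p, q, hq, h⟩ := hf
  obtain ⟨p', q', hq', h'⟩ := hg
  have hp0 : p'.eval 0 ≠ 0 := by rw [← h']; exact mul_ne_zero hq' h0
  -- The extra factor `p'` makes the identity hold also at zeros of `g`, where the quotient takes
  -- the default value zero.
  refine ⟨p * q' * p', q * p' ^ 2, by simp [hq, hp0], fun t => ?_⟩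
  simp only [Polynomial.eval_mul, Polynomial.eval_pow, ← h, ← h']
  by_cases ht : g t = 0
  · simp [ht]
  · field_simp

@[fun_prop]
lemma div_const (hf : RegularAtZero f) (c : K) : RegularAtZero fun t => f t / c := by
  simpa only [div_eq_mul_inv] using hf.mul (const c⁻¹)

lemma eventually_ne_zero (hf : RegularAtZero f) (h0 : f 0 ≠ 0) : ∀ᶠ t in cofinite, f t ≠ 0 := by
  obtain ⟨p, q, hq, h⟩ := hf
  have hp : p ≠ 0 := by
    rintro rfl
    have := h 0
    simp [hq, h0] at this
  rw [eventually_cofinite]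
  refine (p.rootSet_finite K).subset fun t ht => ?_
  rw [Polynomial.mem_rootSet_of_ne hp, Polynomial.coe_aeval_eq_eval, ← h t, not_not.mp ht, mul_zero]

lemma eval_mvPolynomial {σ : Type*} {c : K → σ → K} (hc : ∀ s, RegularAtZero fun t => c t s)
    (P : MvPolynomial σ K) : RegularAtZero fun t => MvPolynomial.eval (c t) P := by
  induction P using MvPolynomial.induction_on with
  | C r => simpa using const r
  | add p q hp hq => simpa using hp.add hq
  | mul_X p s hp => simpa using hp.mul (hc s)

lemma shiftCoeff {a : K → ℕ → ℕ → K} (ha : ∀ i k, RegularAtZero fun t => a t i k) :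
    ∀ d i k, RegularAtZero fun t => Filiform.shiftCoeff (a t) d i k
  | 0, _, _ => const 0
  | 1, i, k => ha i k
  | d + 2, i, k => (shiftCoeff ha (d + 1) i (k - 1)).sub (shiftCoeff ha d (i + 1) k)

lemma vergneCoeff {a : K → ℕ → ℕ → K} (ha : ∀ i k, RegularAtZero fun t => a t i k) (i j k : ℕ) :
    RegularAtZero fun t => Filiform.vergneCoeff (a t) i j k := by
  unfold Filiform.vergneCoeff
  split_ifs
  · exact const 1
  · exact const 0
  · exact const (-1)
  · exact const 0
  · exact shiftCoeff ha _ _ _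
  · exact (shiftCoeff ha _ _ _).neg

end RegularAtZero

end Regular

/-! ### Curves through a rigid point -/

section Deformation

open Filter

variable {K : Type*} [Field K] {L : Type*} [LieRing L] [LieAlgebra K L]
  {b v : Module.Basis (Fin 11) K L} {a : ℕ → ℕ → K}

lemma IsVergneBasis.jacobiRelations (h : IsVergneBasis v a) : JacobiRelations a :=
  jacobiRelations_of_vergnePoint_mem_lieVariety h.coeff_eq_zero
    (h.structureConstants_eq ▸ structureConstants_mem_lieVariety v)

/-- A rigid Lie algebra is isomorphic to some other member of any curve through it. -/
lemma IsRigidIn.exists_isVergneBasis [CharZero K]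
    (hr : IsRigidIn (vergneFilSet 11 K) (structureConstants b)) (h : IsVergneBasis v a)
    (A : K → ℕ → ℕ → K) (hreg : ∀ i k, RegularAtZero fun t => A t i k)
    (hA0 : ∀ i k, A 0 i k = a i k)
    (hlow : ∀ t i k, 1 ≤ i → k < 2 * i + 2 → A t i k = 0)
    (hJ : ∀ᶠ t in cofinite, JacobiRelations (A t)) :
    ∃ t ≠ 0, ∃ v' : Module.Basis (Fin 11) K L, IsVergneBasis v' (A t) := by
  obtain ⟨I, hI⟩ := hr
  have hmem : ∀ {a : ℕ → ℕ → K}, (∀ i k, 1 ≤ i → k < 2 * i + 2 → a i k = 0) →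
      JacobiRelations a → vergnePoint 11 a ∈ vergneFilSet 11 K :=
    fun ha hJ => vergnePoint_mem_vergneFilSet ha (vergnePoint_mem_lieVariety ha hJ)
  have h0 : vergnePoint 11 a ∉ MvPolynomial.zeroLocus K I := by
    have : vergnePoint 11 a ∈ vergneFilSet 11 K ∩ orbit (structureConstants b) :=
      ⟨hmem h.coeff_eq_zero h.jacobiRelations,
        h.structureConstants_eq ▸ structureConstants_mem_orbit b v⟩
    rw [hI] at this
    exact this.2
  rw [MvPolynomial.mem_zeroLocus_iff] at h0
  push Not at h0
  obtain ⟨P, hP, hP0⟩ := h0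
  have hA0' : A 0 = a := funext₂ hA0
  -- `P` pulled back along the curve is regular and nonzero at `0`, hence nonzero for all but
  -- finitely many `t`.
  have hPt := (RegularAtZero.eval_mvPolynomial (c := fun t => vergnePoint 11 (A t))
    (fun s => RegularAtZero.vergneCoeff hreg _ _ _) P).eventually_ne_zero
      (by simpa [hA0', MvPolynomial.aeval_eq_eval] using hP0)
  obtain ⟨t, ⟨ht, hJt⟩, ht0⟩ := ((hPt.and hJ).and (eventually_cofinite_ne 0)).exists
  have : vergnePoint 11 (A t) ∈ vergneFilSet 11 K ∩ orbit (structureConstants b) := by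
    rw [hI]
    refine ⟨hmem (hlow t) hJt, fun hz => ht ?_⟩
    simpa [MvPolynomial.aeval_eq_eval] using (MvPolynomial.mem_zeroLocus_iff.mp hz) P hP
  obtain ⟨v', hv'⟩ := exists_basis_of_mem_orbit b this.2
  exact ⟨t, ht0, v', hlow t, hv'⟩

/-- Replace the coefficients of weight at most three, other than those that have to vanish. -/
def replaceCoeffs {R : Type*} (a : ℕ → ℕ → R) (x₁ x₂ x₃ x₄ y₁ y₂ y₃ z₁ z₂ z₃ : R) : ℕ → ℕ → R
  | 1, 4 => x₁
  | 2, 6 => x₂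
  | 3, 8 => x₃
  | 4, 10 => x₄
  | 1, 5 => y₁
  | 2, 7 => y₂
  | 3, 9 => y₃
  | 1, 6 => z₁
  | 2, 8 => z₂
  | 3, 10 => z₃
  | i, k => a i k

lemma replaceCoeffs_induction {R : Type*} {a : ℕ → ℕ → R} {x₁ x₂ x₃ x₄ y₁ y₂ y₃ z₁ z₂ z₃ : R}
    (P : ℕ → ℕ → R → Prop) (h : ∀ i k, P i k (a i k)) (hx₁ : P 1 4 x₁) (hx₂ : P 2 6 x₂)
    (hx₃ : P 3 8 x₃) (hx₄ : P 4 10 x₄) (hy₁ : P 1 5 y₁) (hy₂ : P 2 7 y₂) (hy₃ : P 3 9 y₃)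
    (hz₁ : P 1 6 z₁) (hz₂ : P 2 8 z₂) (hz₃ : P 3 10 z₃) (i k : ℕ) :
    P i k (replaceCoeffs a x₁ x₂ x₃ x₄ y₁ y₂ y₃ z₁ z₂ z₃ i k) := by
  unfold replaceCoeffs
  split <;> first | assumption | apply h

/-- A rigid Lie algebra is isomorphic to some other member of any curve through it along which only
coefficients of weight at most three vary. -/
lemma IsRigidIn.exists_deformation [CharZero K]
    (hr : IsRigidIn (vergneFilSet 11 K) (structureConstants b)) (h : IsVergneBasis v a)
    (x₁ x₂ x₃ x₄ y₁ y₂ y₃ z₁ z₂ z₃ : K → K)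
    (hJ : ∀ᶠ t in cofinite, 3 * x₂ t ^ 2 - 2 * x₁ t * x₃ t - x₂ t * x₃ t = 0 ∧
      x₄ t * (x₂ t + x₃ t - 2 * x₁ t) + 4 * x₂ t * x₃ t - 6 * x₃ t ^ 2 = 0 ∧
      (7 * x₂ t - 3 * x₃ t) * y₂ t - 3 * x₃ t * y₁ t - (2 * x₁ t + x₂ t) * y₃ t = 0 ∧
      (2 * x₄ t - 4 * x₃ t) * z₁ t + (8 * x₂ t - 6 * x₃ t + x₄ t) * z₂ t
        - (2 * x₁ t + x₂ t) * z₃ t + 4 * y₂ t ^ 2 - 3 * y₁ t * y₃ t - 3 * y₂ t * y₃ t = 0)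
    (ex₁ : x₁ 0 = a 1 4 := by first | assumption | simp)
    (ex₂ : x₂ 0 = a 2 6 := by first | assumption | simp)
    (ex₃ : x₃ 0 = a 3 8 := by first | assumption | simp)
    (ex₄ : x₄ 0 = a 4 10 := by first | assumption | simp)
    (ey₁ : y₁ 0 = a 1 5 := by first | assumption | simp)
    (ey₂ : y₂ 0 = a 2 7 := by first | assumption | simp)
    (ey₃ : y₃ 0 = a 3 9 := by first | assumption | simp)
    (ez₁ : z₁ 0 = a 1 6 := by first | assumption | simp)
    (ez₂ : z₂ 0 = a 2 8 := by first | assumption | simp)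
    (ez₃ : z₃ 0 = a 3 10 := by first | assumption | simp)
    (rx₁ : RegularAtZero x₁ := by fun_prop) (rx₂ : RegularAtZero x₂ := by fun_prop)
    (rx₃ : RegularAtZero x₃ := by fun_prop) (rx₄ : RegularAtZero x₄ := by fun_prop)
    (ry₁ : RegularAtZero y₁ := by fun_prop) (ry₂ : RegularAtZero y₂ := by fun_prop)
    (ry₃ : RegularAtZero y₃ := by fun_prop) (rz₁ : RegularAtZero z₁ := by fun_prop)
    (rz₂ : RegularAtZero z₂ := by fun_prop) (rz₃ : RegularAtZero z₃ := by fun_prop) :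
    ∃ t ≠ 0, ∃ (v' : Module.Basis (Fin 11) K L) (a' : ℕ → ℕ → K), IsVergneBasis v' a' ∧
      (a' 1 4 = x₁ t ∧ a' 2 6 = x₂ t ∧ a' 3 8 = x₃ t ∧ a' 4 10 = x₄ t) ∧
      (a' 1 5 = y₁ t ∧ a' 2 7 = y₂ t ∧ a' 3 9 = y₃ t) ∧
      a' 1 6 = z₁ t ∧ a' 2 8 = z₂ t ∧ a' 3 10 = z₃ t := by
  let A : ℕ → ℕ → K → K :=
    replaceCoeffs (fun i k _ => a i k) x₁ x₂ x₃ x₄ y₁ y₂ y₃ z₁ z₂ z₃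
  obtain ⟨t, ht, v', hv'⟩ := hr.exists_isVergneBasis h (fun t i k => A i k t)
    (replaceCoeffs_induction (fun _ _ (f : K → K) => RegularAtZero f) (fun _ _ => .const _)
      rx₁ rx₂ rx₃ rx₄ ry₁ ry₂ ry₃ rz₁ rz₂ rz₃)
    (replaceCoeffs_induction (fun i k (f : K → K) => f 0 = a i k) (fun _ _ => rfl)
      ex₁ ex₂ ex₃ ex₄ ey₁ ey₂ ey₃ ez₁ ez₂ ez₃)
    (fun t => replaceCoeffs_induction (fun i k (f : K → K) => 1 ≤ i → k < 2 * i + 2 → f t = 0)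
      h.coeff_eq_zero (by omega) (by omega) (by omega) (by omega) (by omega) (by omega) (by omega)
      (by omega) (by omega) (by omega))
    (hJ.mono fun t ht => ⟨ht.1, ht.2.1, ht.2.2.1, ht.2.2.2⟩)
  exact ⟨t, ht, v', _, hv', ⟨rfl, rfl, rfl, rfl⟩, ⟨rfl, rfl, rfl⟩, rfl, rfl, rfl⟩

end Deformation

/-! ### The five strata -/

section NonRigid

open Filter

variable {K : Type*} [Field K] [CharZero K] {L : Type*} [LieRing L] [LieAlgebra K L]
  {b v : Module.Basis (Fin 11) K L} {a : ℕ → ℕ → K}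

/-- The generic stratum is a graph over the free coefficients; the ratio `a 1 4 : a 2 6` moves on
it. -/
lemma not_isRigidIn_of_two_mul_add_ne_zero (h : IsVergneBasis v a) (hs : 2 * a 1 4 + a 2 6 ≠ 0) :
    ¬ IsRigidIn (vergneFilSet 11 K) (structureConstants b) := by
  intro hr
  obtain ⟨e1, e2, e3, e4⟩ := h.jacobiRelations
  -- This is, up to sign, the coefficient of `a 4 10` in `quadratic_two`, and is needed to solve for
  -- `a 4 10`.
  have hd : 2 * a 1 4 - a 2 6 - a 3 8 ≠ 0 := by
    intro hd
    have h6 : a 3 8 * (4 * a 2 6 - 6 * a 3 8) = 0 := by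
      linear_combination e2 + a 4 10 * hd
    have h2 : a 3 8 = 0 := by
      rcases mul_eq_zero.mp h6 with h6 | h6
      · exact h6
      -- Here `a 2 6 = 3/2 * a 3 8` and `2 * a 1 4 = 5/2 * a 3 8`, so `quadratic_one` reads `11/4 *
      -- a 3 8 ^ 2 = 0`.
      · refine pow_eq_zero_iff two_ne_zero |>.mp ?_
        linear_combination (4 / 11) * e1 + (4 / 11 * a 3 8) * hd
          - (3 / 11 * a 2 6 + 5 / 22 * a 3 8) * h6
    have h1 : a 2 6 = 0 := by
      rw [h2] at e1
      refine pow_eq_zero_iff two_ne_zero |>.mp ?_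
      linear_combination e1 / 3
    exact hs (by linear_combination hd + 2 * h1 + h2)
  set s := 2 * a 1 4 + a 2 6
  -- The four relations are solved in turn for `a 3 8`, `a 4 10`, `a 3 9`, `a 3 10`. Moving `(a 1 4,
  -- a 2 6)` by `(t, -2t)` keeps `s` fixed, so the scaling factor must be 1.
  let x₃ : K → K := fun t => 3 * (a 2 6 - 2 * t) ^ 2 / s
  let d : K → K := fun t => 2 * (a 1 4 + t) - (a 2 6 - 2 * t) - x₃ t
  let x₄ : K → K := fun t => (4 * (a 2 6 - 2 * t) * x₃ t - 6 * x₃ t ^ 2) / d t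
  let y₃ : K → K := fun t => ((7 * (a 2 6 - 2 * t) - 3 * x₃ t) * a 2 7 - 3 * x₃ t * a 1 5) / s
  let z₃ : K → K := fun t => ((2 * x₄ t - 4 * x₃ t) * a 1 6
    + (8 * (a 2 6 - 2 * t) - 6 * x₃ t + x₄ t) * a 2 8 + 4 * a 2 7 ^ 2 - 3 * a 1 5 * y₃ t
    - 3 * a 2 7 * y₃ t) / s
  have hx₃ : x₃ 0 = a 3 8 := by
    simp only [x₃]; rw [div_eq_iff hs]; linear_combination e1
  have hd0 : d 0 = 2 * a 1 4 - a 2 6 - a 3 8 := by simp only [d, hx₃]; ring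
  have hx₄ : x₄ 0 = a 4 10 := by
    simp only [x₄, hd0, hx₃]; rw [div_eq_iff hd]; linear_combination e2
  have hy₃ : y₃ 0 = a 3 9 := by
    simp only [y₃, hx₃]; rw [div_eq_iff hs]; linear_combination e3
  have hz₃ : z₃ 0 = a 3 10 := by
    simp only [z₃, hx₃, hx₄, hy₃]; rw [div_eq_iff hs]; linear_combination e4
  have rx₃ : RegularAtZero x₃ := by fun_prop
  have rd : RegularAtZero d := by fun_prop
  have rx₄ : RegularAtZero x₄ := .div (by fun_prop) rd (by rwa [hd0])
  have ry₃ : RegularAtZero y₃ := by fun_prop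
  have rz₃ : RegularAtZero z₃ := by fun_prop
  obtain ⟨t, ht, v', a', h', ⟨k1, k2, -, -⟩, -, -⟩ := hr.exists_deformation h
    (fun t => a 1 4 + t) (fun t => a 2 6 - 2 * t) x₃ x₄ (fun _ => a 1 5) (fun _ => a 2 7) y₃
    (fun _ => a 1 6) (fun _ => a 2 8) z₃
    (by
      filter_upwards [rd.eventually_ne_zero (by rwa [hd0])] with t ht
      have f3 : x₃ t * s = 3 * (a 2 6 - 2 * t) ^ 2 := div_mul_cancel₀ _ hs
      have f4 : x₄ t * d t = 4 * (a 2 6 - 2 * t) * x₃ t - 6 * x₃ t ^ 2 := div_mul_cancel₀ _ ht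
      have g3 : y₃ t * s = _ := div_mul_cancel₀ _ hs
      have w3 : z₃ t * s = _ := div_mul_cancel₀ _ hs
      simp only [d, s] at f3 f4 g3 w3 ⊢
      exact ⟨by linear_combination -f3, by linear_combination -f4, by linear_combination -g3,
        by linear_combination -w3⟩)
  obtain ⟨r, hr0, r1, r2, -, -⟩ := h.exists_weight_one_eq h'
  rw [k1] at r1
  rw [k2] at r2
  have hr1 : r = 1 := mul_right_cancel₀ hs (by linear_combination -2 * r1 - r2)
  rw [hr1] at r1
  exact ht (by linear_combination r1)

/-- With `a 3 8` invertible, `a 2 6` can be moved off zero, whereas a common scaling would keep it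
zero. -/
lemma not_isRigidIn_of_weight_one_three_ne_zero (h : IsVergneBasis v a) (h1 : a 1 4 = 0)
    (h2 : a 2 6 = 0) (h3 : a 3 8 ≠ 0) :
    ¬ IsRigidIn (vergneFilSet 11 K) (structureConstants b) := by
  intro hr
  obtain ⟨e1, e2, e3, e4⟩ := h.jacobiRelations
  rw [h1, h2] at e1 e2 e3 e4
  have h4 : a 4 10 = 6 * a 3 8 := mul_right_cancel₀ h3 (by linear_combination e2)
  -- With `a 2 6 = t`, the relations are solved in turn for `a 1 4`, `a 4 10`, `a 1 5`, `a 1 6`. The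
  -- last denominator `q` is nonzero at `0` because `a 4 10 = 6 * a 3 8` there.
  let x₁ : K → K := fun t => (3 * t ^ 2 / a 3 8 - t) / 2
  let d : K → K := fun t => 2 * x₁ t - t - a 3 8
  let x₄ : K → K := fun t => (4 * t * a 3 8 - 6 * a 3 8 ^ 2) / d t
  let y₁ : K → K := fun t =>
    ((7 * t - 3 * a 3 8) * a 2 7 - (2 * x₁ t + t) * a 3 9) / (3 * a 3 8)
  let q : K → K := fun t => 2 * x₄ t - 4 * a 3 8
  let z₁ : K → K := fun t => ((2 * x₁ t + t) * a 3 10 - (8 * t - 6 * a 3 8 + x₄ t) * a 2 8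
    - 4 * a 2 7 ^ 2 + 3 * y₁ t * a 3 9 + 3 * a 2 7 * a 3 9) / q t
  have hx₁ : x₁ 0 = 0 := by simp [x₁]
  have hd0 : d 0 = - a 3 8 := by simp [d, hx₁]
  have hx₄ : x₄ 0 = a 4 10 := by
    simp only [x₄, hd0]; rw [div_eq_iff (neg_ne_zero.mpr h3), h4]; ring
  have hy₁ : y₁ 0 = a 1 5 := by
    simp only [y₁, hx₁]; rw [div_eq_iff (by simpa using h3)]; linear_combination e3
  have hq0 : q 0 = 8 * a 3 8 := by simp only [q, hx₄, h4]; ring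
  have hq : q 0 ≠ 0 := by rw [hq0]; simpa using h3
  have hz₁ : z₁ 0 = a 1 6 := by
    simp only [z₁, hx₁, hx₄, hy₁]; rw [div_eq_iff hq, hq0]
    linear_combination -e4 + 2 * a 1 6 * h4
  have rx₁ : RegularAtZero x₁ := by fun_prop
  have rd : RegularAtZero d := by fun_prop
  have hd : d 0 ≠ 0 := by rw [hd0]; exact neg_ne_zero.mpr h3
  have rx₄ : RegularAtZero x₄ := .div (by fun_prop) rd hd
  have ry₁ : RegularAtZero y₁ := by fun_prop
  have rq : RegularAtZero q := by fun_prop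
  have rz₁ : RegularAtZero z₁ := .div (by fun_prop) rq hq
  obtain ⟨t, ht, v', a', h', ⟨-, k2, k3, -⟩, -, -⟩ := hr.exists_deformation h
    x₁ (fun t => t) (fun _ => a 3 8) x₄ y₁ (fun _ => a 2 7) (fun _ => a 3 9)
    z₁ (fun _ => a 2 8) (fun _ => a 3 10)
    (by
      filter_upwards [rd.eventually_ne_zero hd, rq.eventually_ne_zero hq] with t htd htq
      have f1 : 2 * x₁ t * a 3 8 = 3 * t ^ 2 - t * a 3 8 := by simp only [x₁]; field_simp
      have f4 : x₄ t * d t = 4 * t * a 3 8 - 6 * a 3 8 ^ 2 := div_mul_cancel₀ _ htd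
      have g1 : y₁ t * (3 * a 3 8) = _ := div_mul_cancel₀ _ (by simpa using h3)
      have w1 : z₁ t * q t = _ := div_mul_cancel₀ _ htq
      simp only [d, q] at f4 g1 w1 ⊢
      exact ⟨by linear_combination -f1, by linear_combination -f4, by linear_combination -g1,
        by linear_combination w1⟩) (by rw [hx₁, h1]) (by rw [h2])
  obtain ⟨r, hr0, -, r2, r3, -⟩ := h.exists_weight_one_eq h'
  rw [k2, h2, mul_zero] at r2
  exact ht r2

/-- The case in which a coefficient of weight two can be moved arbitrarily. -/
lemma not_isRigidIn_of_weight_one_four_ne_zero (h : IsVergneBasis v a) (h1 : a 1 4 = 0)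
    (h2 : a 2 6 = 0) (h3 : a 3 8 = 0) (h4 : a 4 10 ≠ 0) :
    ¬ IsRigidIn (vergneFilSet 11 K) (structureConstants b) := by
  intro hr
  obtain ⟨e1, e2, e3, e4⟩ := h.jacobiRelations
  rw [h1, h2, h3] at e4
  have key : ∀ c₁ c₂ : K, ∃ t ≠ 0, ∃ r ≠ 0, a 1 5 + c₁ * t = r * a 1 5 ∧
      a 2 7 + c₂ * t = r * a 2 7 := by
    intro c₁ c₂
    let y₁ : K → K := fun t => a 1 5 + c₁ * t
    let y₂ : K → K := fun t => a 2 7 + c₂ * t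
    -- Only `quartic` is left, and `a 4 10 ≠ 0` lets `a 1 6` absorb any motion in weight two.
    let z₁ : K → K := fun t => -(a 4 10 * a 2 8 + 4 * y₂ t ^ 2 - 3 * y₁ t * a 3 9
      - 3 * y₂ t * a 3 9) / (2 * a 4 10)
    have hz₁ : z₁ 0 = a 1 6 := by
      simp only [z₁, y₁, y₂]; rw [div_eq_iff (by simpa using h4)]; linear_combination -e4
    have ry₁ : RegularAtZero y₁ := by fun_prop
    have ry₂ : RegularAtZero y₂ := by fun_prop
    have rz₁ : RegularAtZero z₁ := by fun_prop
    obtain ⟨t, ht, v', a', h', -, ⟨k1, k2, -⟩, -⟩ := hr.exists_deformation h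
      (fun _ => 0) (fun _ => 0) (fun _ => 0) (fun _ => a 4 10) y₁ y₂ (fun _ => a 3 9)
      z₁ (fun _ => a 2 8) (fun _ => a 3 10)
      (by
        filter_upwards with t
        have w1 : z₁ t * (2 * a 4 10) = _ := div_mul_cancel₀ _ (by simpa using h4)
        exact ⟨by ring, by ring, by ring, by linear_combination w1⟩)
      h1.symm h2.symm h3.symm rfl (by simp [y₁]) (by simp [y₂])
    obtain ⟨r, hr0, r1, r2, -⟩ := h.exists_weight_two_eq h' h1 h2 h3
    exact ⟨t, ht, r, hr0, by rw [← r1, k1], by rw [← r2, k2]⟩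
  -- A zero `a 1 5` is moved off zero; a nonzero one is held fixed, which forces the scaling factor
  -- to be 1, while `a 2 7` moves.
  by_cases h5 : a 1 5 = 0
  · obtain ⟨t, ht, r, -, r1, -⟩ := key 1 0
    rw [h5] at r1
    exact ht (by linear_combination r1)
  · obtain ⟨t, ht, r, -, r1, r2⟩ := key 0 1
    have hr1 : r = 1 := mul_right_cancel₀ h5 (by linear_combination -r1)
    rw [hr1] at r2
    exact ht (by linear_combination r2)

/-- The weight-two coefficients are confined to the cone `4 y₂² = 3 (y₁ + y₂) y₃`, over a conic.
Moving along the conic changes their ratios. -/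
lemma not_isRigidIn_of_weight_one_eq_zero (h : IsVergneBasis v a) (h1 : a 1 4 = 0)
    (h2 : a 2 6 = 0) (h3 : a 3 8 = 0) (h4 : a 4 10 = 0)
    (h5 : ¬ (a 1 5 = 0 ∧ a 2 7 = 0 ∧ a 3 9 = 0)) :
    ¬ IsRigidIn (vergneFilSet 11 K) (structureConstants b) := by
  intro hr
  obtain ⟨e1, e2, e3, e4⟩ := h.jacobiRelations
  rw [h1, h2, h3, h4] at e4
  -- All weight-three coefficients are unconstrained along a curve on `4 y₂² = 3 (y₁ + y₂) y₃`.
  have key : ∀ y₁ y₂ y₃ : K → K, RegularAtZero y₁ → RegularAtZero y₂ → RegularAtZero y₃ →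
      y₁ 0 = a 1 5 → y₂ 0 = a 2 7 → y₃ 0 = a 3 9 →
      (∀ t, 4 * y₂ t ^ 2 = 3 * (y₁ t + y₂ t) * y₃ t) →
      ∃ t ≠ 0, ∃ r ≠ 0, y₁ t = r * a 1 5 ∧ y₂ t = r * a 2 7 ∧ y₃ t = r * a 3 9 := by
    intro y₁ y₂ y₃ ry₁ ry₂ ry₃ hy₁ hy₂ hy₃ hQ
    obtain ⟨t, ht, v', a', h', -, ⟨k1, k2, k3⟩, -⟩ := hr.exists_deformation h
      (fun _ => 0) (fun _ => 0) (fun _ => 0) (fun _ => 0) y₁ y₂ y₃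
      (fun _ => a 1 6) (fun _ => a 2 8) (fun _ => a 3 10)
      (by
        filter_upwards with t
        exact ⟨by ring, by ring, by ring, by linear_combination hQ t⟩)
      h1.symm h2.symm h3.symm h4.symm
    obtain ⟨r, hr0, r1, r2, r3⟩ := h.exists_weight_two_eq h' h1 h2 h3
    exact ⟨t, ht, r, hr0, by rw [← r1, k1], by rw [← r2, k2], by rw [← r3, k3]⟩
  by_cases hu : a 1 5 + a 2 7 = 0
  · have h7 : a 2 7 = 0 := pow_eq_zero_iff two_ne_zero |>.mp
      (by linear_combination e4 / 4 + 3 / 4 * a 3 9 * hu)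
    have h15 : a 1 5 = 0 := by linear_combination hu - h7
    have h9 : a 3 9 ≠ 0 := fun h9 => h5 ⟨h15, h7, h9⟩
    -- Here only `a 3 9` is nonzero. Holding it fixed, the cone is parametrized by `y₂ = t`, which
    -- leaves zero.
    obtain ⟨t, ht, r, -, -, r2, -⟩ := key (fun t => 4 * t ^ 2 / (3 * a 3 9) - t) (fun t => t)
      (fun _ => a 3 9) (by fun_prop) (by fun_prop) (by fun_prop) (by simp [h15]) (by simp [h7]) rfl
      (fun t => by field_simp; ring)
    exact ht (by rw [r2, h7, mul_zero])
  -- Holding `y₁ + y₂` fixed and nonzero forces the scaling factor to be 1 and determines `y₃` from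
  -- `y₂`.
  · obtain ⟨t, ht, r, -, r1, r2, -⟩ := key (fun t => a 1 5 - t) (fun t => a 2 7 + t)
      (fun t => 4 * (a 2 7 + t) ^ 2 / (3 * (a 1 5 + a 2 7))) (by fun_prop) (by fun_prop)
      (by fun_prop) (by simp) (by simp)
      (by rw [div_eq_iff (by simpa using hu)]; linear_combination e4)
      (fun t => by
        rw [show a 1 5 - t + (a 2 7 + t) = a 1 5 + a 2 7 by ring,
          mul_div_cancel₀ _ (by simpa using hu)])
    have hr1 : r = 1 := mul_right_cancel₀ hu (by linear_combination -r1 - r2)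
    rw [hr1] at r2
    exact ht (by linear_combination r2)

/-- Weight-three coefficients enter the relations only multiplied by weight-one ones, so here they
are free and their ratios can be changed at will. -/
lemma not_isRigidIn_of_weight_two_eq_zero (h : IsVergneBasis v a) (h1 : a 1 4 = 0)
    (h2 : a 2 6 = 0) (h3 : a 3 8 = 0) (h4 : a 4 10 = 0) (h5 : a 1 5 = 0) (h7 : a 2 7 = 0)
    (h9 : a 3 9 = 0) : ¬ IsRigidIn (vergneFilSet 11 K) (structureConstants b) := by
  intro hr
  have key : ∀ c₁ c₂ : K, ∃ t ≠ 0, ∃ r ≠ 0, a 1 6 + c₁ * t = r * a 1 6 ∧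
      a 2 8 + c₂ * t = r * a 2 8 := by
    intro c₁ c₂
    obtain ⟨t, ht, v', a', h', -, -, k1, k2, -⟩ := hr.exists_deformation h
      (fun _ => 0) (fun _ => 0) (fun _ => 0) (fun _ => 0) (fun _ => 0) (fun _ => 0) (fun _ => 0)
      (fun t => a 1 6 + c₁ * t) (fun t => a 2 8 + c₂ * t) (fun _ => a 3 10)
      (by filter_upwards with t; exact ⟨by ring, by ring, by ring, by ring⟩)
      h1.symm h2.symm h3.symm h4.symm h5.symm h7.symm h9.symm
    obtain ⟨r, hr0, r1, r2, -⟩ := h.exists_weight_three_eq h' h1 h2 h3 h4 h5 h7 h9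
    exact ⟨t, ht, r, hr0, by rw [← r1, k1], by rw [← r2, k2]⟩
  by_cases h6 : a 1 6 = 0
  · obtain ⟨t, ht, r, -, r1, -⟩ := key 1 0
    rw [h6] at r1
    exact ht (by linear_combination r1)
  · obtain ⟨t, ht, r, -, r1, r2⟩ := key 0 1
    have hr1 : r = 1 := mul_right_cancel₀ h6 (by linear_combination -r1)
    rw [hr1] at r2
    exact ht (by linear_combination r2)

lemma IsVergneBasis.not_isRigidIn (h : IsVergneBasis v a) :
    ¬ IsRigidIn (vergneFilSet 11 K) (structureConstants b) := by
  by_cases hs : 2 * a 1 4 + a 2 6 = 0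
  swap
  · exact not_isRigidIn_of_two_mul_add_ne_zero h hs
  -- `quadratic_one` says `3 * a 2 6 ^ 2 = a 3 8 * (2 * a 1 4 + a 2 6)`.
  have h2 : a 2 6 = 0 := pow_eq_zero_iff two_ne_zero |>.mp
    (by linear_combination h.jacobiRelations.quadratic_one / 3 + a 3 8 / 3 * hs)
  have h1 : a 1 4 = 0 := by linear_combination hs / 2 - h2 / 2
  by_cases h3 : a 3 8 = 0
  swap
  · exact not_isRigidIn_of_weight_one_three_ne_zero h h1 h2 h3
  by_cases h4 : a 4 10 = 0
  swap
  · exact not_isRigidIn_of_weight_one_four_ne_zero h h1 h2 h3 h4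
  by_cases h5 : a 1 5 = 0 ∧ a 2 7 = 0 ∧ a 3 9 = 0
  · exact not_isRigidIn_of_weight_two_eq_zero h h1 h2 h3 h4 h5.1 h5.2.1 h5.2.2
  · exact not_isRigidIn_of_weight_one_eq_zero h h1 h2 h3 h4 h5

end NonRigid

end Filiform

theorem proposition32 {K : Type*} [Field K] [IsAlgClosed K] [CharZero K]
    {L : Type*} [LieRing L] [LieAlgebra K L] (b : Module.Basis (Fin 11) K L)
    (hL : Filiform.IsFiliform K L) :
    ¬ Filiform.IsRigidIn (Filiform.vergneFilSet 11 K) (Filiform.structureConstants b) ∧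
    ¬ Filiform.IsRigidIn (Filiform.filSet 11 K) (Filiform.structureConstants b) ∧
    ¬ Filiform.IsRigidIn (Filiform.nilVariety 11 K) (Filiform.structureConstants b) ∧
    ¬ Filiform.IsRigidIn (Filiform.lieVariety 11 K) (Filiform.structureConstants b) := by
  -- The Vergne basis guarantees that the orbit meets `vergneFilSet`; an empty intersection would be
  -- open.
  obtain ⟨v, a, hv⟩ := hL.exists_isVergneBasis (by rw [Module.finrank_eq_card_basis b]; simp)
  have h : ¬ Filiform.IsRigidIn (Filiform.vergneFilSet 11 K) (Filiform.structureConstants b) :=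
    hv.not_isRigidIn
  have h1 : Filiform.vergneFilSet 11 K ⊆ Filiform.filSet 11 K := fun c hc => hc.1
  have h2 : Filiform.filSet 11 K ⊆ Filiform.nilVariety 11 K :=
    fun c ⟨hc, hf⟩ => ⟨hc, hf.nilpotent⟩
  have h3 : Filiform.nilVariety 11 K ⊆ Filiform.lieVariety 11 K := fun c ⟨hc, _⟩ => hc
  exact ⟨h, fun hr => h (hr.mono h1), fun hr => h (hr.mono (h1.trans h2)),
    fun hr => h (hr.mono (h1.trans (h2.trans h3)))⟩
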